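/- Let $n\ge 1$ and let $S_{2n-1}$ be the symmetric group on $[2n-1]=\{1,\dots,2n-1\}$. All vector spaces are over $\mathbb C$. A LAnKe is a vector space with an $n$-linear bracket that is antisymmetric, i.e. $[x_1,\dots,x_n]=\operatorname{sgn}(\sigma)[x_{\sigma(1)},\dots,x_{\sigma(n)}]$ for all $\sigma\in S_n$, and satisfies the generalized Jacobi identity $$[[x_1,\dots,x_n],y_1,\dots,y_{n-1}]=\sum_{i=1}^n(-1)^{n-i}[[y_1,\dots,y_{n-1},x_i],x_1,\dots,\widehat{x_i},\dots,x_n].$$ Let $\rho_{n,3}$ be the multilinear component of the free LAnKe on the generators $[2n-1]$, i.e. the span of the bracketed words with exactly two brackets in which each generator occurs exactly once, with $S_{2n-1}$ acting by permuting the generators. Let $V_{n,3}$ be the vector space spanned by the formal combs $[[x_1,\dots,x_n],y_1,\dots,y_{n-1}]$, where $(x_1,\dots,x_n,y_1,\dots,y_{n-1})$ is an arrangement of $[2n-1]$, subject only to antisymmetry in the $x_i$ and antisymmetry in the $y_j$; $S_{2n-1}$ acts by permuting the labels. Let $\varphi:V_{n,3}\to V_{n,3}$ be the $S_{2n-1}$-homomorphism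 $$\varphi([[x_1,\dots,x_n],y_1,\dots,y_{n-1}])=[[x_1,\dots,x_n],y_1,\dots,y_{n-1}]-\sum_{i=1}^n(-1)^{n-i}[[y_1,\dots,y_{n-1},x_i],x_1,\dots,\widehat{x_i},\dots,x_n].$$ For a bijective filling $t$ of the Young diagram of shape $2^{n-1}1$ by $[2n-1]$, with column stabilizer $C_t$, let $\{t\}$ be its row tabloid and $\varepsilon_t=\sum_{\beta\in C_t}\operatorname{sgn}(\beta)\{\beta t\}$ its polytabloid, and let the Specht module $S^{2^{n-1}1}$ be the span of all $\varepsilon_t$. Let $\tilde\Psi:V_{n,3}\to S^{2^{n-1}1}$ be the $S_{2n-1}$-homomorphism that sends $[[x_1,\dots,x_n],y_1,\dots,y_{n-1}]$ to $\varepsilon_t$, where $t$ has first column $x_1,\dots,x_n$ and second column $y_1,\dots,y_{n-1}$ (read from top to bottom). **Theorem.** 1. $V_{n,3}=\ker\varphi\oplus\operatorname{im}\varphi$, and the canonical map $V_{n,3}\to\rho_{n,3}$, which reads a comb in the free LAnKe, restricts to an $S_{2n-1}$-module isomorphism $\kappa:\ker\varphi\to\rho_{n,3}$. 2. The restriction $\Psi=\tilde\Psi|_{\ker\varphi}:\ker\varphi\to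 S^{2^{n-1}1}$ is an $S_{2n-1}$-module isomorphism. Moreover $\Psi\circ\gamma=\tilde\Psi$, where $\gamma:V_{n,3}\to\ker\varphi$ is the projection along $\operatorname{im}\varphi$. 3. Consequently $\Psi\circ\kappa^{-1}:\rho_{n,3}\to S^{2^{n-1}1}$ is an $S_{2n-1}$-module isomorphism, and it sends the element $[[x_1,\dots,x_n],y_1,\dots,y_{n-1}]$ of $\rho_{n,3}$ to $\varepsilon_t$, with $t$ as above. In particular $\dim\rho_{n,3}$ is the Catalan number $C_n=\frac1{n+1}\binom{2n}{n}$. -/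

import Mathlib

/-!
Throughout, the arity of the bracket is `n = m + 1` with `m : ℕ` (so `n ≥ 1` and `n - 1 = m`), and
the symmetric group `S_{2n-1}` is `Equiv.Perm (Fin (2 * m + 1))`.  All vector spaces are over `ℂ`.
-/

/-- The sign of a permutation as a complex number. -/
abbrev sgn {α : Type*} [Fintype α] [DecidableEq α] (σ : Equiv.Perm α) : ℂ :=
  ((Equiv.Perm.sign σ : ℤ) : ℂ)

/-! ### LAnKes -/

/-- A Lie algebra of the `n`-th kind (LAnKe), `n = m + 1`: a complex vector space with an
`n`-linear antisymmetric bracket satisfying the generalized Jacobi identity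
`[[x₁,…,xₙ],y₁,…,yₙ₋₁] = ∑ᵢ (-1)^(n-i) [[y₁,…,yₙ₋₁,xᵢ],x₁,…,x̂ᵢ,…,xₙ]`.
With the index `i : Fin (m + 1)` starting at `0`, the exponent `n - i` becomes `m - i`. -/
class LAnKe (m : ℕ) (L : Type*) [AddCommGroup L] [Module ℂ L] where
  bracket : MultilinearMap ℂ (fun _ : Fin (m + 1) => L) L
  antisymm : ∀ (x : Fin (m + 1) → L) (σ : Equiv.Perm (Fin (m + 1))),
    bracket x = sgn σ • bracket (x ∘ σ)
  jacobi : ∀ (x : Fin (m + 1) → L) (y : Fin m → L),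
    bracket (Fin.cons (bracket x) y : Fin (m + 1) → L) =
      ∑ i : Fin (m + 1), (-1 : ℂ) ^ (m - (i : ℕ)) •
        bracket (Fin.cons (bracket (Fin.snoc y (x i) : Fin (m + 1) → L))
          (fun j => x (i.succAbove j)) : Fin (m + 1) → L)

/-- Homomorphisms of LAnKes: linear maps preserving the bracket. -/
structure LAnKeHom (m : ℕ) (L K : Type*) [AddCommGroup L] [Module ℂ L] [LAnKe m L]
    [AddCommGroup K] [Module ℂ K] [LAnKe m K] extends L →ₗ[ℂ] K where
  map_bracket : ∀ x : Fin (m + 1) → L,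
    toLinearMap (LAnKe.bracket (m := m) x) = LAnKe.bracket (m := m) (fun i => toLinearMap (x i))

/-! ### The free LAnKe

It is built as the formal expressions in the generators, modulo the smallest congruence that forces
the laws of a LAnKe.  The universal property is proved below (`FreeLAnKe.lift_unique`). -/

namespace FreeLAnKe

/-- Formal expressions in generators `X`, a zero, sums, scalar multiples and `n`-fold brackets. -/
inductive Pre (m : ℕ) (X : Type) : Type
  | of : X → Pre m X
  | zero : Pre m X
  | add : Pre m X → Pre m X → Pre m X
  | smul : ℂ → Pre m X → Pre m X
  | br : (Fin (m + 1) → Pre m X) → Pre m X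

/-- Finite sums of formal expressions. -/
def Pre.sum {m : ℕ} {X : Type} : {k : ℕ} → (Fin k → Pre m X) → Pre m X
  | 0, _ => Pre.zero
  | _ + 1, f => Pre.add (f 0) (Pre.sum fun i => f i.succ)

/-- The smallest congruence making the formal expressions a LAnKe. -/
inductive Rel (m : ℕ) (X : Type) : Pre m X → Pre m X → Prop
  | refl (a) : Rel m X a a
  | symm {a b} : Rel m X a b → Rel m X b a
  | trans {a b c} : Rel m X a b → Rel m X b c → Rel m X a c
  | add_congr {a a' b b'} : Rel m X a a' → Rel m X b b' → Rel m X (.add a b) (.add a' b')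
  | smul_congr (c : ℂ) {a a'} : Rel m X a a' → Rel m X (.smul c a) (.smul c a')
  | br_congr {v w : Fin (m + 1) → Pre m X} :
      (∀ i, Rel m X (v i) (w i)) → Rel m X (.br v) (.br w)
  | add_comm (a b) : Rel m X (.add a b) (.add b a)
  | add_assoc (a b c) : Rel m X (.add (.add a b) c) (.add a (.add b c))
  | zero_add (a) : Rel m X (.add .zero a) a
  | one_smul (a) : Rel m X (.smul 1 a) a
  | mul_smul (c d : ℂ) (a) : Rel m X (.smul (c * d) a) (.smul c (.smul d a))
  | smul_add (c : ℂ) (a b) : Rel m X (.smul c (.add a b)) (.add (.smul c a) (.smul c b))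
  | add_smul (c d : ℂ) (a) : Rel m X (.smul (c + d) a) (.add (.smul c a) (.smul d a))
  | zero_smul (a) : Rel m X (.smul 0 a) .zero
  | smul_zero (c : ℂ) : Rel m X (.smul c .zero) .zero
  | br_add (v : Fin (m + 1) → Pre m X) (i : Fin (m + 1)) (a b) :
      Rel m X (.br (Function.update v i (.add a b)))
        (.add (.br (Function.update v i a)) (.br (Function.update v i b)))
  | br_smul (v : Fin (m + 1) → Pre m X) (i : Fin (m + 1)) (c : ℂ) (a) :
      Rel m X (.br (Function.update v i (.smul c a))) (.smul c (.br (Function.update v i a)))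
  | antisymm (v : Fin (m + 1) → Pre m X) (σ : Equiv.Perm (Fin (m + 1))) :
      Rel m X (.br v) (.smul (sgn σ) (.br (v ∘ σ)))
  | jacobi (x : Fin (m + 1) → Pre m X) (y : Fin m → Pre m X) :
      Rel m X (.br (Fin.cons (.br x) y : Fin (m + 1) → Pre m X))
        (Pre.sum fun i : Fin (m + 1) => .smul ((-1 : ℂ) ^ (m - (i : ℕ)))
          (.br (Fin.cons (.br (Fin.snoc y (x i) : Fin (m + 1) → Pre m X))
            (fun j => x (i.succAbove j)) : Fin (m + 1) → Pre m X)))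

def setoid (m : ℕ) (X : Type) : Setoid (Pre m X) :=
  ⟨Rel m X, ⟨Rel.refl, Rel.symm, Rel.trans⟩⟩

end FreeLAnKe

/-- The free LAnKe of arity `n = m + 1` on the set `X`. -/
def FreeLAnKe (m : ℕ) (X : Type) : Type := Quotient (FreeLAnKe.setoid m X)

namespace FreeLAnKe

variable {m : ℕ} {X : Type}

def mk (a : Pre m X) : FreeLAnKe m X := Quotient.mk (setoid m X) a

theorem mk_eq {a b : Pre m X} (h : Rel m X a b) : mk a = mk b :=
  Quotient.sound (s := setoid m X) h

theorem mk_eq_iff {a b : Pre m X} : mk a = mk b ↔ Rel m X a b :=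
  ⟨fun h => Quotient.exact (s := setoid m X) h, mk_eq⟩

theorem mk_surjective (a : FreeLAnKe m X) : ∃ p : Pre m X, mk p = a :=
  Quotient.exists_rep (s := setoid m X) a

/-- The generators. -/
def of (x : X) : FreeLAnKe m X := mk (.of x)

instance : Zero (FreeLAnKe m X) := ⟨mk .zero⟩
instance : Add (FreeLAnKe m X) :=
  ⟨Quotient.map₂ (sa := setoid m X) (sb := setoid m X) (sc := setoid m X) Pre.add
    fun _ _ h _ _ h' => Rel.add_congr h h'⟩
instance : SMul ℂ (FreeLAnKe m X) :=
  ⟨fun c => Quotient.map (sa := setoid m X) (sb := setoid m X) (Pre.smul c)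
    fun _ _ h => Rel.smul_congr c h⟩
instance : Neg (FreeLAnKe m X) := ⟨fun a => (-1 : ℂ) • a⟩

theorem mk_zero : (mk .zero : FreeLAnKe m X) = 0 := rfl
theorem mk_add (a b : Pre m X) : mk (.add a b) = mk a + mk b := rfl
theorem mk_smul (c : ℂ) (a : Pre m X) : mk (.smul c a) = c • mk a := rfl

theorem zero_add_aux (a : FreeLAnKe m X) : 0 + a = a := by
  obtain ⟨a, rfl⟩ := mk_surjective a
  exact mk_eq (.zero_add a)

theorem add_comm_aux (a b : FreeLAnKe m X) : a + b = b + a := by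
  obtain ⟨a, rfl⟩ := mk_surjective a
  obtain ⟨b, rfl⟩ := mk_surjective b
  exact mk_eq (.add_comm a b)

theorem one_smul_aux (a : FreeLAnKe m X) : (1 : ℂ) • a = a := by
  obtain ⟨a, rfl⟩ := mk_surjective a
  exact mk_eq (.one_smul a)

theorem add_smul_aux (c d : ℂ) (a : FreeLAnKe m X) : (c + d) • a = c • a + d • a := by
  obtain ⟨a, rfl⟩ := mk_surjective a
  exact mk_eq (.add_smul c d a)

theorem zero_smul_aux (a : FreeLAnKe m X) : (0 : ℂ) • a = 0 := by
  obtain ⟨a, rfl⟩ := mk_surjective a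
  exact mk_eq (.zero_smul a)

instance : AddCommGroup (FreeLAnKe m X) where
  add_assoc a b c := by
    obtain ⟨a, rfl⟩ := mk_surjective a
    obtain ⟨b, rfl⟩ := mk_surjective b
    obtain ⟨c, rfl⟩ := mk_surjective c
    exact mk_eq (.add_assoc a b c)
  zero_add := zero_add_aux
  add_zero a := by rw [add_comm_aux, zero_add_aux]
  nsmul := nsmulRec
  zsmul := zsmulRec
  neg_add_cancel a := by
    have h : (-1 : ℂ) • a + (1 : ℂ) • a = 0 := by
      rw [← add_smul_aux, neg_add_cancel, zero_smul_aux]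
    rwa [one_smul_aux] at h
  add_comm := add_comm_aux

instance : Module ℂ (FreeLAnKe m X) where
  one_smul := one_smul_aux
  mul_smul c d a := by
    obtain ⟨a, rfl⟩ := mk_surjective a
    exact mk_eq (.mul_smul c d a)
  smul_zero c := mk_eq (.smul_zero c)
  smul_add c a b := by
    obtain ⟨a, rfl⟩ := mk_surjective a
    obtain ⟨b, rfl⟩ := mk_surjective b
    exact mk_eq (.smul_add c a b)
  add_smul := add_smul_aux
  zero_smul := zero_smul_aux

theorem mk_sum {k : ℕ} (f : Fin k → Pre m X) : mk (Pre.sum f) = ∑ i, mk (f i) := by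
  induction k with
  | zero => simp [Pre.sum, mk_zero]
  | succ k ih => rw [Pre.sum, mk_add, ih, Fin.sum_univ_succ]

/-- The bracket of the free LAnKe, as a function: apply `Pre.br` to representatives. -/
noncomputable def brFun (v : Fin (m + 1) → FreeLAnKe m X) : FreeLAnKe m X :=
  mk (.br fun i => (mk_surjective (v i)).choose)

theorem brFun_mk (v : Fin (m + 1) → Pre m X) : brFun (fun i => mk (v i)) = mk (.br v) :=
  mk_eq (.br_congr fun i => mk_eq_iff.1 (mk_surjective (mk (v i))).choose_spec)

theorem exists_rep (v : Fin (m + 1) → FreeLAnKe m X) :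
    ∃ w : Fin (m + 1) → Pre m X, v = fun i => mk (w i) :=
  ⟨fun i => (mk_surjective (v i)).choose, funext fun i => (mk_surjective (v i)).choose_spec.symm⟩

theorem update_mk (w : Fin (m + 1) → Pre m X) (i : Fin (m + 1)) (a : Pre m X) :
    Function.update (fun i => mk (w i)) i (mk a) = fun j => mk (Function.update w i a j) := by
  funext j
  by_cases h : j = i
  · subst h; simp
  · simp [h]

noncomputable def bracketMap : MultilinearMap ℂ (fun _ : Fin (m + 1) => FreeLAnKe m X)
    (FreeLAnKe m X) where
  toFun := brFun
  map_update_add' {inst} v i a b := by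
    obtain ⟨w, rfl⟩ := exists_rep v
    obtain ⟨a, rfl⟩ := mk_surjective a
    obtain ⟨b, rfl⟩ := mk_surjective b
    obtain rfl : inst = instDecidableEqFin (m + 1) := Subsingleton.elim _ _
    rw [← mk_add, update_mk, update_mk, update_mk, brFun_mk, brFun_mk, brFun_mk]
    exact mk_eq (.br_add w i a b)
  map_update_smul' {inst} v i c a := by
    obtain ⟨w, rfl⟩ := exists_rep v
    obtain ⟨a, rfl⟩ := mk_surjective a
    obtain rfl : inst = instDecidableEqFin (m + 1) := Subsingleton.elim _ _
    rw [← mk_smul, update_mk, update_mk, brFun_mk, brFun_mk]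
    exact mk_eq (.br_smul w i c a)

theorem bracketMap_mk (v : Fin (m + 1) → Pre m X) :
    bracketMap (fun i => mk (v i)) = mk (.br v) := brFun_mk v

theorem cons_mk (a : Pre m X) (y : Fin m → Pre m X) :
    (Fin.cons (mk a) (fun j => mk (y j)) : Fin (m + 1) → FreeLAnKe m X) =
      fun i => mk ((Fin.cons a y : Fin (m + 1) → Pre m X) i) := by
  funext i
  refine Fin.cases ?_ (fun j => ?_) i <;> simp

theorem snoc_mk (a : Pre m X) (y : Fin m → Pre m X) :
    (Fin.snoc (fun j => mk (y j)) (mk a) : Fin (m + 1) → FreeLAnKe m X) =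
      fun i => mk ((Fin.snoc y a : Fin (m + 1) → Pre m X) i) := by
  funext i
  refine Fin.lastCases ?_ (fun j => ?_) i <;> simp

noncomputable instance : LAnKe m (FreeLAnKe m X) where
  bracket := bracketMap
  antisymm x σ := by
    obtain ⟨w, rfl⟩ := exists_rep x
    have : ((fun i => mk (w i)) ∘ σ : Fin (m + 1) → FreeLAnKe m X) =
      fun i => mk ((w ∘ σ) i) := rfl
    rw [this, bracketMap_mk, bracketMap_mk, ← mk_smul]
    exact mk_eq (.antisymm w σ)
  jacobi x y := by
    obtain ⟨x, rfl⟩ := exists_rep x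
    obtain ⟨y, rfl⟩ : ∃ w : Fin m → Pre m X, y = fun i => mk (w i) :=
      ⟨fun i => (mk_surjective (y i)).choose,
        funext fun i => (mk_surjective (y i)).choose_spec.symm⟩
    simp only [snoc_mk, bracketMap_mk, cons_mk]
    rw [mk_eq (.jacobi x y), mk_sum]
    simp only [mk_smul]

/-- Evaluation of formal expressions in a LAnKe. -/
noncomputable def evalPre {K : Type*} [AddCommGroup K] [Module ℂ K] [LAnKe m K] (f : X → K) :
    Pre m X → K
  | .of x => f x
  | .zero => 0
  | .add a b => evalPre f a + evalPre f b
  | .smul c a => c • evalPre f a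
  | .br v => LAnKe.bracket (m := m) fun i => evalPre f (v i)

section lift

variable {K : Type*} [AddCommGroup K] [Module ℂ K] [LAnKe m K] (f : X → K)

theorem evalPre_sum {k : ℕ} (g : Fin k → Pre m X) :
    evalPre f (Pre.sum g) = ∑ i, evalPre f (g i) := by
  induction k with
  | zero => simp [Pre.sum, evalPre]
  | succ k ih => rw [Pre.sum, evalPre, ih, Fin.sum_univ_succ]

theorem evalPre_update (v : Fin (m + 1) → Pre m X) (i : Fin (m + 1)) (a : Pre m X) :
    (fun j => evalPre f (Function.update v i a j)) =
      Function.update (fun j => evalPre f (v j)) i (evalPre f a) := by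
  funext j
  by_cases h : j = i
  · subst h; simp
  · simp [h]

theorem evalPre_cons (a : Pre m X) (y : Fin m → Pre m X) :
    (fun i => evalPre f ((Fin.cons a y : Fin (m + 1) → Pre m X) i)) =
      (Fin.cons (evalPre f a) (fun j => evalPre f (y j)) : Fin (m + 1) → K) := by
  funext i
  refine Fin.cases ?_ (fun j => ?_) i <;> simp

theorem evalPre_snoc (a : Pre m X) (y : Fin m → Pre m X) :
    (fun i => evalPre f ((Fin.snoc y a : Fin (m + 1) → Pre m X) i)) =
      (Fin.snoc (fun j => evalPre f (y j)) (evalPre f a) : Fin (m + 1) → K) := by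
  funext i
  refine Fin.lastCases ?_ (fun j => ?_) i <;> simp

theorem evalPre_rel {a b : Pre m X} (h : Rel m X a b) : evalPre f a = evalPre f b := by
  induction h with
  | refl => rfl
  | symm _ ih => exact ih.symm
  | trans _ _ ih ih' => exact ih.trans ih'
  | add_congr _ _ ih ih' => simp only [evalPre, ih, ih']
  | smul_congr c _ ih => simp only [evalPre, ih]
  | br_congr _ ih => simp only [evalPre, ih]
  | add_comm a b => exact _root_.add_comm _ _
  | add_assoc a b c => exact _root_.add_assoc _ _ _
  | zero_add a => exact _root_.zero_add _
  | one_smul a => exact _root_.one_smul _ _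
  | mul_smul c d a => exact SemigroupAction.mul_smul _ _ _
  | smul_add c a b => exact _root_.smul_add _ _ _
  | add_smul c d a => exact _root_.add_smul _ _ _
  | zero_smul a => exact _root_.zero_smul _ _
  | smul_zero c => exact _root_.smul_zero _
  | br_add v i a b => simp only [evalPre, evalPre_update, MultilinearMap.map_update_add]
  | br_smul v i c a => simp only [evalPre, evalPre_update, MultilinearMap.map_update_smul]
  | antisymm v σ => exact LAnKe.antisymm (m := m) (fun i => evalPre f (v i)) σ
  | jacobi x y =>
    simp only [evalPre, evalPre_sum, evalPre_cons, evalPre_snoc]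
    exact LAnKe.jacobi (m := m) (fun i => evalPre f (x i)) (fun i => evalPre f (y i))

/-- The LAnKe homomorphism out of the free LAnKe determined by the images of the generators. -/
noncomputable def lift : LAnKeHom m (FreeLAnKe m X) K where
  toFun := Quotient.lift (s := setoid m X) (evalPre f) fun _ _ h => evalPre_rel f h
  map_add' a b := by
    obtain ⟨a, rfl⟩ := mk_surjective a
    obtain ⟨b, rfl⟩ := mk_surjective b
    rfl
  map_smul' c a := by
    obtain ⟨a, rfl⟩ := mk_surjective a
    rfl
  map_bracket v := by
    obtain ⟨w, rfl⟩ := exists_rep v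
    exact congrArg (Quotient.lift (s := setoid m X) (evalPre f) fun _ _ h => evalPre_rel f h)
      (bracketMap_mk w)

theorem lift_of (x : X) : (lift f : LAnKeHom m (FreeLAnKe m X) K).toLinearMap (of x) = f x := rfl

theorem lift_unique (F : LAnKeHom m (FreeLAnKe m X) K)
    (hF : ∀ x, F.toLinearMap (of x) = f x) : F.toLinearMap = (lift f).toLinearMap := by
  ext a
  obtain ⟨a, rfl⟩ := mk_surjective a
  induction a with
  | of x => exact hF x
  | zero => rw [mk_zero, map_zero, map_zero]
  | add a b iha ihb => rw [mk_add, map_add, map_add, iha, ihb]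
  | smul c a ih => rw [mk_smul, map_smul, map_smul, ih]
  | br v ih =>
    have h : mk (.br v) = LAnKe.bracket (m := m) fun i => mk (v i) := (bracketMap_mk v).symm
    rw [h, F.map_bracket, (lift f).map_bracket]
    simp only [ih]

end lift

/-- The endomorphism of the free LAnKe induced by a map of generators. -/
noncomputable def map (g : X → X) : LAnKeHom m (FreeLAnKe m X) (FreeLAnKe m X) :=
  lift fun x => of (g x)

theorem map_id_aux : (map (id : X → X)).toLinearMap =
    (LinearMap.id : FreeLAnKe m X →ₗ[ℂ] FreeLAnKe m X) :=
  (lift_unique (m := m) (fun x : X => of (id x)) ⟨LinearMap.id, fun _ => rfl⟩ fun _ => rfl).symm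

theorem map_comp_aux (g h : X → X) : (map (m := m) (g ∘ h)).toLinearMap =
    (map (m := m) g).toLinearMap ∘ₗ (map (m := m) h).toLinearMap := by
  refine (lift_unique (m := m) (fun x : X => of ((g ∘ h) x))
    ⟨(map (m := m) g).toLinearMap ∘ₗ (map (m := m) h).toLinearMap, fun x => ?_⟩
    fun _ => rfl).symm
  rw [LinearMap.comp_apply, (map h).map_bracket, (map g).map_bracket]
  rfl

/-- Permutations of the generators act on the free LAnKe. -/
noncomputable def rep (m : ℕ) (X : Type) : Representation ℂ (Equiv.Perm X) (FreeLAnKe m X) where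
  toFun σ := (map (m := m) σ).toLinearMap
  map_one' := map_id_aux
  map_mul' σ τ := map_comp_aux σ τ

end FreeLAnKe

/-! ### The multilinear component -/

/-- Bracketed words in the generators `X`. -/
inductive BracketWord (m : ℕ) (X : Type) : Type
  | of : X → BracketWord m X
  | br : (Fin (m + 1) → BracketWord m X) → BracketWord m X

namespace BracketWord

variable {m : ℕ} {X : Type}

/-- The element of the free LAnKe represented by a bracketed word. -/
noncomputable def eval : BracketWord m X → FreeLAnKe m X
  | .of x => FreeLAnKe.of x
  | .br v => LAnKe.bracket (m := m) fun i => eval (v i)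

/-- The number of occurrences of the generator `x`. -/
def occ [DecidableEq X] (x : X) : BracketWord m X → ℕ
  | .of y => if y = x then 1 else 0
  | .br v => ∑ i, occ x (v i)

/-- The number of brackets. -/
def numBr : BracketWord m X → ℕ
  | .of _ => 0
  | .br v => 1 + ∑ i, numBr (v i)

/-- Relabelling the generators. -/
def relabel (g : X → X) : BracketWord m X → BracketWord m X
  | .of x => .of (g x)
  | .br v => .br fun i => relabel g (v i)

theorem eval_relabel (σ : Equiv.Perm X) (w : BracketWord m X) :
    (w.relabel σ).eval = FreeLAnKe.rep m X σ w.eval := by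
  induction w with
  | of x => rfl
  | br v ih =>
    rw [relabel, eval, eval]
    refine Eq.trans ?_ ((FreeLAnKe.map (m := m) σ).map_bracket _).symm
    simp only [ih]
    rfl

theorem numBr_relabel (g : X → X) (w : BracketWord m X) : (w.relabel g).numBr = w.numBr := by
  induction w with
  | of x => rfl
  | br v ih => simp only [relabel, numBr, ih]

theorem occ_relabel [DecidableEq X] (σ : Equiv.Perm X) (x : X) (w : BracketWord m X) :
    (w.relabel σ).occ x = w.occ (σ⁻¹ x) := by
  induction w with
  | of y => simp only [relabel, occ, Equiv.Perm.eq_inv_iff_eq]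
  | br v ih => simp only [relabel, occ, ih]

end BracketWord

/-- The bracketed words that span the multilinear component: two brackets, every one of the
`2n - 1` generators exactly once. (For `n ≥ 2` the second condition implies the first one.) -/
def multilinearWords (m : ℕ) : Set (BracketWord m (Fin (2 * m + 1))) :=
  {w | w.numBr = 2 ∧ ∀ x, w.occ x = 1}

/-- The multilinear component of the free LAnKe on `2n - 1` generators, with its action of
`S_{2n-1}`. -/
noncomputable def rhoSub (m : ℕ) : Subrepresentation (FreeLAnKe.rep m (Fin (2 * m + 1))) where
  toSubmodule := Submodule.span ℂ (BracketWord.eval '' multilinearWords m)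
  apply_mem_toSubmodule σ v hv := by
    induction hv using Submodule.span_induction with
    | mem v hv =>
      obtain ⟨w, ⟨hw, hw'⟩, rfl⟩ := hv
      refine Submodule.subset_span ⟨w.relabel σ, ⟨?_, fun x => ?_⟩, w.eval_relabel σ⟩
      · rw [w.numBr_relabel, hw]
      · rw [w.occ_relabel, hw']
    | zero => rw [map_zero]; exact Submodule.zero_mem _
    | add x y _ _ hx hy => rw [map_add]; exact Submodule.add_mem _ hx hy
    | smul c x _ hx => rw [map_smul]; exact Submodule.smul_mem _ c hx

/-- The representation `ρ_{n,3}`. -/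
noncomputable abbrev rho (m : ℕ) :
    Representation ℂ (Equiv.Perm (Fin (2 * m + 1))) (rhoSub m).toSubmodule :=
  (rhoSub m).toRepresentation

/-! ### Labellings of the shape `2^(n-1) 1` -/

/-- The cells of the Young diagram of shape `2^(n-1) 1`: `inl i` is the `i`-th cell of the first
column (of length `n`), `inr j` the `j`-th cell of the second column (of length `n - 1`). -/
abbrev Cell (m : ℕ) : Type := Fin (m + 1) ⊕ Fin m

/-- The row of a cell. -/
def Cell.row {m : ℕ} : Cell m → Fin (m + 1) := Sum.elim id Fin.castSucc

/-- The column of a cell. -/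
def Cell.col {m : ℕ} : Cell m → Fin 2 := Sum.elim (fun _ => 0) (fun _ => 1)

/-- The fillings of the shape `2^(n-1) 1` in which each of the `2n - 1` labels appears once.
Such a filling, with first column `x₁,…,xₙ` and second column `y₁,…,yₙ₋₁`, is the same as a comb
`[[x₁,…,xₙ],y₁,…,yₙ₋₁]`; it is used both as a tableau and as a comb. -/
def Tableau (m : ℕ) : Type := Cell m ≃ Fin (2 * m + 1)

namespace Tableau

variable {m : ℕ}

/-- The label of a cell. -/
def label (t : Tableau m) (c : Cell m) : Fin (2 * m + 1) := Equiv.toFun t c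

/-- The cell containing a label. -/
def cell (t : Tableau m) (a : Fin (2 * m + 1)) : Cell m := Equiv.invFun t a

/-- Rearranging the positions: the new label of the cell `c` is the old label of `p c`. -/
def rearrange (t : Tableau m) (p : Equiv.Perm (Cell m)) : Tableau m := Equiv.trans p t

/-- Permutations act on tableaux through the labels. -/
instance : MulAction (Equiv.Perm (Fin (2 * m + 1))) (Tableau m) where
  smul σ t := Equiv.trans t σ
  one_smul _ := rfl
  mul_smul _ _ _ := rfl

theorem label_smul (σ : Equiv.Perm (Fin (2 * m + 1))) (t : Tableau m) (c : Cell m) :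
    (σ • t).label c = σ (t.label c) := rfl

theorem cell_smul (σ : Equiv.Perm (Fin (2 * m + 1))) (t : Tableau m) (a : Fin (2 * m + 1)) :
    (σ • t).cell a = t.cell (σ⁻¹ a) := rfl

theorem smul_rearrange (σ : Equiv.Perm (Fin (2 * m + 1))) (t : Tableau m)
    (p : Equiv.Perm (Cell m)) : (σ • t).rearrange p = σ • t.rearrange p := rfl

end Tableau

/-! ### The Specht module `S^{2^(n-1) 1}` -/

/-- Two tableaux are row equivalent if they have the same entries in each row. -/
def rowSetoid (m : ℕ) : Setoid (Tableau m) where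
  r t s := ∀ a, (t.cell a).row = (s.cell a).row
  iseqv := ⟨fun _ _ => rfl, fun h a => (h a).symm, fun h h' a => (h a).trans (h' a)⟩

/-- Row tabloids. -/
def Tabloid (m : ℕ) : Type := Quotient (rowSetoid m)

/-- The row tabloid `{t}`. -/
def Tabloid.mk {m : ℕ} (t : Tableau m) : Tabloid m := Quotient.mk (rowSetoid m) t

instance (m : ℕ) : MulAction (Equiv.Perm (Fin (2 * m + 1))) (Tabloid m) where
  smul σ := Quotient.map (sa := rowSetoid m) (sb := rowSetoid m) (fun t => σ • t)
    fun _ _ h a => h (σ⁻¹ a)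
  one_smul T := by
    induction T using Quotient.inductionOn with
    | h t => rfl
  mul_smul σ τ T := by
    induction T using Quotient.inductionOn with
    | h t => rfl

theorem Tabloid.smul_mk {m : ℕ} (σ : Equiv.Perm (Fin (2 * m + 1))) (t : Tableau m) :
    σ • Tabloid.mk t = Tabloid.mk (σ • t) := rfl

/-- The permutation module spanned by the row tabloids. -/
noncomputable def tabloidRep (m : ℕ) :
    Representation ℂ (Equiv.Perm (Fin (2 * m + 1))) (Tabloid m →₀ ℂ) where
  toFun σ := Finsupp.lmapDomain ℂ ℂ (fun T => σ • T)
  map_one' := Finsupp.lhom_ext' fun T => LinearMap.ext_ring (by simp)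
  map_mul' σ τ := Finsupp.lhom_ext' fun T => LinearMap.ext_ring (by simp [mul_smul])

theorem tabloidRep_single {m : ℕ} (σ : Equiv.Perm (Fin (2 * m + 1))) (T : Tabloid m) (c : ℂ) :
    tabloidRep m σ (Finsupp.single T c) = Finsupp.single (σ • T) c :=
  Finsupp.mapDomain_single

/-- `β` belongs to the column stabilizer `C_t`. -/
abbrev InColStab {m : ℕ} (t : Tableau m) (β : Equiv.Perm (Fin (2 * m + 1))) : Prop :=
  ∀ a, (t.cell (β a)).col = (t.cell a).col

/-- The polytabloid `ε_t = ∑_{β ∈ C_t} sgn(β) {β t}`. -/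
noncomputable def polytabloid {m : ℕ} (t : Tableau m) : Tabloid m →₀ ℂ :=
  ∑ β : Equiv.Perm (Fin (2 * m + 1)) with InColStab t β,
    sgn β • Finsupp.single (Tabloid.mk (β • t)) (1 : ℂ)

theorem tabloidRep_polytabloid {m : ℕ} (σ : Equiv.Perm (Fin (2 * m + 1))) (t : Tableau m) :
    tabloidRep m σ (polytabloid t) = polytabloid (σ • t) := by
  unfold polytabloid
  rw [map_sum]
  refine Finset.sum_equiv (MulAut.conj σ).toEquiv (fun β => ?_) fun β _ => ?_
  · rw [Finset.mem_filter_univ, Finset.mem_filter_univ]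
    constructor
    · intro h a
      simpa [Tableau.cell_smul] using h (σ⁻¹ a)
    · intro h a
      simpa [Tableau.cell_smul] using h (σ a)
  · rw [map_smul, tabloidRep_single, Tabloid.smul_mk]
    have hs : Equiv.Perm.sign ((MulAut.conj σ).toEquiv β) = Equiv.Perm.sign β := by
      change Equiv.Perm.sign (σ * β * σ⁻¹) = _
      rw [Equiv.Perm.sign_mul, Equiv.Perm.sign_mul, Equiv.Perm.sign_inv, mul_comm, ← mul_assoc,
        Int.units_mul_self, one_mul]
    have hm : (MulAut.conj σ).toEquiv β • σ • t = σ • β • t := by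
      simp [smul_smul]
    rw [show sgn ((MulAut.conj σ).toEquiv β) = sgn β by rw [sgn, hs], hm]

/-- The Specht module: the span of the polytabloids, as a subrepresentation. -/
noncomputable def spechtSub (m : ℕ) : Subrepresentation (tabloidRep m) where
  toSubmodule := Submodule.span ℂ (Set.range polytabloid)
  apply_mem_toSubmodule σ v hv := by
    induction hv using Submodule.span_induction with
    | mem v hv =>
      obtain ⟨t, rfl⟩ := hv
      exact Submodule.subset_span ⟨σ • t, (tabloidRep_polytabloid σ t).symm⟩
    | zero => rw [map_zero]; exact Submodule.zero_mem _
    | add x y _ _ hx hy => rw [map_add]; exact Submodule.add_mem _ hx hy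
    | smul c x _ hx => rw [map_smul]; exact Submodule.smul_mem _ c hx

/-- The Specht module `S^{2^(n-1) 1}` as a representation of `S_{2n-1}`. -/
noncomputable abbrev specht (m : ℕ) :
    Representation ℂ (Equiv.Perm (Fin (2 * m + 1))) (spechtSub m).toSubmodule :=
  (spechtSub m).toRepresentation

/-- The polytabloid `ε_t` as an element of the Specht module. -/
noncomputable def spechtPolytabloid {m : ℕ} (t : Tableau m) : (spechtSub m).toSubmodule :=
  ⟨polytabloid t, Submodule.subset_span ⟨t, rfl⟩⟩

/-! ### The comb space `V_{n,3}` -/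

/-- The antisymmetry relations `[[x],y] - sgn(σ) sgn(τ) [[x ∘ σ], y ∘ τ]` between combs. -/
noncomputable def combRelations (m : ℕ) : Submodule ℂ (Tableau m →₀ ℂ) :=
  Submodule.span ℂ {r | ∃ (t : Tableau m) (σ : Equiv.Perm (Fin (m + 1)))
    (τ : Equiv.Perm (Fin m)), r = Finsupp.single t (1 : ℂ) -
      (sgn σ * sgn τ) • Finsupp.single (t.rearrange (Equiv.sumCongr σ τ)) (1 : ℂ)}

/-- The space `V_{n,3}` of antisymmetric multilinear left combs (without the Jacobi identity). -/
abbrev CombSpace (m : ℕ) : Type := (Tableau m →₀ ℂ) ⧸ combRelations m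

/-- The class in `V_{n,3}` of the comb `[[x₁,…,xₙ],y₁,…,yₙ₋₁]`, where `x` and `y` are the columns
of `t`. -/
noncomputable def comb {m : ℕ} (t : Tableau m) : CombSpace m :=
  (combRelations m).mkQ (Finsupp.single t 1)

theorem comb_rearrange {m : ℕ} (t : Tableau m) (σ : Equiv.Perm (Fin (m + 1)))
    (τ : Equiv.Perm (Fin m)) :
    comb t = (sgn σ * sgn τ) • comb (t.rearrange (Equiv.sumCongr σ τ)) := by
  rw [← sub_eq_zero]
  unfold comb
  rw [← map_smul, ← map_sub]
  exact (Submodule.Quotient.mk_eq_zero _).2 (Submodule.subset_span ⟨t, σ, τ, rfl⟩)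

/-- Linear maps out of `V_{n,3}` are given by their values on combs. -/
noncomputable def combLift {m : ℕ} {W : Type*} [AddCommGroup W] [Module ℂ W] (f : Tableau m → W)
    (hf : ∀ (t : Tableau m) (σ : Equiv.Perm (Fin (m + 1))) (τ : Equiv.Perm (Fin m)),
      f t = (sgn σ * sgn τ) • f (t.rearrange (Equiv.sumCongr σ τ))) : CombSpace m →ₗ[ℂ] W :=
  (combRelations m).liftQ (Finsupp.linearCombination ℂ f) <| Submodule.span_le.2 <| by
    rintro _ ⟨t, σ, τ, rfl⟩
    simp only [SetLike.mem_coe, LinearMap.mem_ker, map_sub, map_smul,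
      Finsupp.linearCombination_single, one_smul]
    exact sub_eq_zero.2 (hf t σ τ)

theorem combLift_comb {m : ℕ} {W : Type*} [AddCommGroup W] [Module ℂ W] (f : Tableau m → W)
    (hf) (t : Tableau m) : combLift f hf (comb t) = f t := by
  refine (Submodule.liftQ_apply _ _ _).trans ?_
  rw [Finsupp.linearCombination_single, one_smul]

theorem combSpace_hom_ext {m : ℕ} {W : Type*} [AddCommGroup W] [Module ℂ W]
    {F G : CombSpace m →ₗ[ℂ] W} (h : ∀ t, F (comb t) = G (comb t)) : F = G := by
  refine Submodule.linearMap_qext _ (Finsupp.lhom_ext' fun t => LinearMap.ext_ring ?_)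
  exact h t

theorem comb_smul_rearrange {m : ℕ} (ρ : Equiv.Perm (Fin (2 * m + 1))) (t : Tableau m)
    (σ : Equiv.Perm (Fin (m + 1))) (τ : Equiv.Perm (Fin m)) :
    comb (ρ • t) = (sgn σ * sgn τ) • comb (ρ • t.rearrange (Equiv.sumCongr σ τ)) := by
  rw [comb_rearrange (ρ • t) σ τ, Tableau.smul_rearrange]

/-- `S_{2n-1}` acts on `V_{n,3}` by permuting the labels of the combs. -/
noncomputable def combRep (m : ℕ) :
    Representation ℂ (Equiv.Perm (Fin (2 * m + 1))) (CombSpace m) where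
  toFun ρ := combLift (fun t => comb (ρ • t)) (comb_smul_rearrange ρ)
  map_one' := combSpace_hom_ext fun t => by
    rw [combLift_comb, one_smul]; rfl
  map_mul' ρ ρ' := combSpace_hom_ext fun t => by
    rw [combLift_comb, Module.End.mul_apply, combLift_comb, combLift_comb, mul_smul]

theorem combRep_comb {m : ℕ} (ρ : Equiv.Perm (Fin (2 * m + 1))) (t : Tableau m) :
    combRep m ρ (comb t) = comb (ρ • t) := by
  exact combLift_comb (fun t => comb (ρ • t)) (comb_smul_rearrange ρ) t

/-! ### The map `φ` -/

/-- The rearrangement of positions taking the comb `[[x₁,…,xₙ],y₁,…,yₙ₋₁]` to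
`[[y₁,…,yₙ₋₁,xᵢ],x₁,…,x̂ᵢ,…,xₙ]`. -/
noncomputable def jacobiPerm {m : ℕ} (i : Fin (m + 1)) : Equiv.Perm (Cell m) :=
  Equiv.ofBijective
    (Sum.elim (Fin.snoc (fun j => Sum.inr j) (Sum.inl i) : Fin (m + 1) → Cell m)
      (fun j => Sum.inl (i.succAbove j)))
    (Finite.injective_iff_bijective.1 (by
      rintro (a | a) (b | b)
      · refine Fin.lastCases ?_ (fun a => ?_) a <;> refine Fin.lastCases ?_ (fun b => ?_) b <;> simp
      · refine Fin.lastCases ?_ (fun a => ?_) a <;> simp [(Fin.succAbove_ne i b).symm]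
      · refine Fin.lastCases ?_ (fun b => ?_) b <;> simp [Fin.succAbove_ne i a]
      · simp))

/-- The sum on the right-hand side of the generalized Jacobi identity for the comb `t`. -/
noncomputable def combJacobiSum {m : ℕ} (t : Tableau m) : CombSpace m :=
  ∑ i : Fin (m + 1), (-1 : ℂ) ^ (m - (i : ℕ)) • comb (t.rearrange (jacobiPerm i))

theorem exists_minor {m : ℕ} (σ : Equiv.Perm (Fin (m + 1))) (i : Fin (m + 1)) :
    ∃ b : Equiv.Perm (Fin m), (∀ j, (σ i).succAbove (b j) = σ (i.succAbove j)) ∧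
      Equiv.Perm.sign b = Equiv.Perm.sign σ * (-1) ^ ((i : ℕ) + (σ i : ℕ)) := by
  obtain ⟨⟨p, b⟩, hb⟩ := Equiv.Perm.decomposeFin.symm.surjective
    ((σ i).cycleRange * σ * i.cycleRange⁻¹)
  have h0 : p = 0 := by
    have := congrArg (fun f => f 0) hb
    simpa using this
  subst h0
  refine ⟨b, fun j => ?_, ?_⟩
  · have := congrArg (fun f => f j.succ) hb
    simp at this
    apply (σ i).cycleRange.injective
    rw [Fin.cycleRange_succAbove, this]
  · have := congrArg Equiv.Perm.sign hb
    simp only [Equiv.Perm.decomposeFin.symm_sign, if_true, one_mul, Equiv.Perm.sign_mul,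
      Equiv.Perm.sign_inv, Fin.sign_cycleRange] at this
    rw [this, pow_add]
    ac_rfl

theorem combJacobiSum_rearrange {m : ℕ} (t : Tableau m) (σ : Equiv.Perm (Fin (m + 1)))
    (τ : Equiv.Perm (Fin m)) :
    combJacobiSum t = (sgn σ * sgn τ) • combJacobiSum (t.rearrange (Equiv.sumCongr σ τ)) := by
  unfold combJacobiSum
  rw [Finset.smul_sum, ← Equiv.sum_comp σ]
  refine Finset.sum_congr rfl fun i _ => ?_
  obtain ⟨b, hb, hs⟩ := exists_minor σ i
  let a : Equiv.Perm (Fin (m + 1)) := finSuccEquivLast.symm.permCongr τ.optionCongr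
  have ha : Equiv.Perm.sign a = Equiv.Perm.sign τ := by
    simp [a, Equiv.optionCongr_sign]
  have key : (t.rearrange (jacobiPerm (σ i))).rearrange (Equiv.sumCongr a b) =
      (t.rearrange (Equiv.sumCongr σ τ)).rearrange (jacobiPerm i) := by
    refine Equiv.ext fun c => congrArg (Equiv.toFun t) ?_
    rcases c with c | c
    · refine Fin.lastCases ?_ (fun c => ?_) c <;> simp [jacobiPerm, a]
    · simp [jacobiPerm, hb]
  rw [comb_rearrange (t.rearrange (jacobiPerm (σ i))) a b, key, smul_smul, smul_smul]
  congr 1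
  have h1 : sgn b = sgn σ * (-1) ^ ((i : ℕ) + (σ i : ℕ)) := by simp [sgn, hs]
  have h2 : sgn a = sgn τ := by simp only [sgn, ha]
  rw [h1, h2]
  have e1 : ∀ k : Fin (m + 1), (-1 : ℂ) ^ (m - (k : ℕ)) = (-1) ^ m * (-1) ^ (k : ℕ) := by
    intro k
    rw [← pow_add]
    have h : m + (k : ℕ) = (m - (k : ℕ)) + 2 * k := by
      have := k.is_le
      omega
    rw [h, pow_add, pow_mul]
    simp
  rw [e1, e1, pow_add]
  have e2 : (-1 : ℂ) ^ (σ i : ℕ) * (-1 : ℂ) ^ (σ i : ℕ) = 1 := by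
    rw [← mul_pow]; simp
  linear_combination (-1 : ℂ) ^ m * (-1 : ℂ) ^ (i : ℕ) * sgn σ * sgn τ * e2

theorem sub_combJacobiSum_rearrange {m : ℕ} (t : Tableau m) (σ : Equiv.Perm (Fin (m + 1)))
    (τ : Equiv.Perm (Fin m)) : comb t - combJacobiSum t = (sgn σ * sgn τ) •
      (comb (t.rearrange (Equiv.sumCongr σ τ)) -
        combJacobiSum (t.rearrange (Equiv.sumCongr σ τ))) := by
  rw [smul_sub, ← comb_rearrange, ← combJacobiSum_rearrange]

/-- The map `φ : V_{n,3} → V_{n,3}`,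
`φ [[x],y] = [[x],y] - ∑ᵢ (-1)^(n-i) [[y₁,…,yₙ₋₁,xᵢ],x₁,…,x̂ᵢ,…,xₙ]`. -/
noncomputable def phi (m : ℕ) : (combRep m).IntertwiningMap (combRep m) where
  toLinearMap := combLift (fun t => comb t - combJacobiSum t) sub_combJacobiSum_rearrange
  isIntertwining' ρ := combSpace_hom_ext fun t => by
    simp only [LinearMap.comp_apply, combRep_comb, combLift_comb, map_sub, combJacobiSum, map_sum,
      map_smul, Tableau.smul_rearrange]

/-! ### The map `Ψ̃ : V_{n,3} → S^{2^(n-1) 1}` -/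

theorem rearrange_eq_smul {m : ℕ} (t : Tableau m) (p : Equiv.Perm (Cell m)) :
    t.rearrange p = ((show Cell m ≃ Fin (2 * m + 1) from t).permCongr p) • t := by
  refine Equiv.ext fun c => ?_
  change t.toFun (p c) = t.toFun (p (t.invFun (t.toFun c)))
  rw [t.left_inv]

theorem polytabloid_rearrange {m : ℕ} (t : Tableau m) (σ : Equiv.Perm (Fin (m + 1)))
    (τ : Equiv.Perm (Fin m)) :
    polytabloid t = (sgn σ * sgn τ) • polytabloid (t.rearrange (Equiv.sumCongr σ τ)) := by
  set p : Equiv.Perm (Cell m) := Equiv.sumCongr σ τ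
  set π : Equiv.Perm (Fin (2 * m + 1)) := (show Cell m ≃ Fin (2 * m + 1) from t).permCongr p
  have hp : ∀ c, (p c).col = c.col := by rintro (c | c) <;> rfl
  have hp' : ∀ c, (p⁻¹ c).col = c.col := fun c => by
    have h := hp (p⁻¹ c)
    rw [Equiv.Perm.inv_def, Equiv.apply_symm_apply] at h
    exact h.symm
  have hs : sgn π = sgn σ * sgn τ := by
    have h1 : Equiv.Perm.sign π = Equiv.Perm.sign p := Equiv.Perm.sign_permCongr _ _
    have h2 : Equiv.Perm.sign p = Equiv.Perm.sign σ * Equiv.Perm.sign τ :=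
      Equiv.Perm.sign_sumCongr σ τ
    simp [sgn, h1, h2]
  have hcell : ∀ a, t.cell (π⁻¹ a) = p⁻¹ (t.cell a) := fun a => by
    change t.invFun (t.toFun (p.symm (t.invFun a))) = p.symm (t.invFun a)
    rw [t.left_inv]
  have hcol : ∀ a, ((π • t).cell a).col = (t.cell a).col := fun a => by
    rw [Tableau.cell_smul, hcell, hp']
  have hss : sgn π * sgn π = 1 := by
    rcases Int.units_eq_one_or (Equiv.Perm.sign π) with h | h <;> simp [sgn, h]
  rw [rearrange_eq_smul, ← hs]
  change polytabloid t = sgn π • polytabloid (π • t)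
  unfold polytabloid
  rw [Finset.smul_sum]
  refine Finset.sum_equiv (Equiv.mulRight π⁻¹) (fun β => ?_) fun β _ => ?_
  · rw [Finset.mem_filter_univ, Finset.mem_filter_univ]
    have hπ : ∀ a, (t.cell (π⁻¹ a)).col = (t.cell a).col := fun a => by rw [hcell, hp']
    simp only [InColStab, hcol, Equiv.coe_mulRight, Equiv.Perm.mul_apply]
    constructor
    · intro h a
      rw [h, hπ]
    · intro h a
      have := h (π a)
      have hi : π⁻¹ (π a) = a := π.symm_apply_apply a
      rwa [hi, ← hπ (π a), hi] at this
  · rw [Equiv.coe_mulRight, smul_smul, smul_smul, inv_mul_cancel_right]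
    congr 1
    simp only [sgn, Equiv.Perm.sign_mul, Equiv.Perm.sign_inv, Units.val_mul, Int.cast_mul] at hss ⊢
    linear_combination (-((Equiv.Perm.sign β : ℤ) : ℂ)) * hss

theorem spechtPolytabloid_rearrange {m : ℕ} (t : Tableau m) (σ : Equiv.Perm (Fin (m + 1)))
    (τ : Equiv.Perm (Fin m)) : spechtPolytabloid t =
      (sgn σ * sgn τ) • spechtPolytabloid (t.rearrange (Equiv.sumCongr σ τ)) :=
  Subtype.ext (polytabloid_rearrange t σ τ)

/-- The map `Ψ̃` sending the comb `[[x],y]` to the polytabloid of the tableau with columns `x` and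
`y`. -/
noncomputable def psiTilde (m : ℕ) : (combRep m).IntertwiningMap (specht m) where
  toLinearMap := combLift spechtPolytabloid spechtPolytabloid_rearrange
  isIntertwining' ρ := by
    refine combSpace_hom_ext (W := (spechtSub m).toSubmodule) fun t => ?_
    rw [LinearMap.comp_apply, LinearMap.comp_apply, combRep_comb, combLift_comb, combLift_comb]
    exact Subtype.ext (tabloidRep_polytabloid ρ t).symm

/-! ### The canonical map from combs to the free LAnKe -/

/-- The bracketed word `[[x₁,…,xₙ],y₁,…,yₙ₋₁]`. -/
def combWord {m : ℕ} (t : Tableau m) : BracketWord m (Fin (2 * m + 1)) :=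
  .br (Fin.cons (.br fun i => .of (t.label (.inl i))) fun j => .of (t.label (.inr j)))

theorem combWord_mem {m : ℕ} (t : Tableau m) : combWord t ∈ multilinearWords m := by
  constructor
  · simp [combWord, BracketWord.numBr, Fin.sum_univ_succ]
  · intro x
    have h : ∑ c : Cell m, (if t.label c = x then 1 else 0) = 1 := by
      have : ∀ c, t.label c = x ↔ c = t.cell x := fun c =>
        (Equiv.eq_symm_apply (show Cell m ≃ Fin (2 * m + 1) from t)).symm
      simp [this]
    rw [Fintype.sum_sum_type] at h
    rw [combWord, BracketWord.occ, Fin.sum_univ_succ]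
    simpa [BracketWord.occ] using h

/-- The element `[[x₁,…,xₙ],y₁,…,yₙ₋₁]` of `ρ_{n,3}`. -/
noncomputable def rhoComb {m : ℕ} (t : Tableau m) : (rhoSub m).toSubmodule :=
  ⟨(combWord t).eval, Submodule.subset_span ⟨combWord t, combWord_mem t, rfl⟩⟩

theorem combWord_eval {m : ℕ} (t : Tableau m) : (combWord t).eval =
    LAnKe.bracket (m := m) (Fin.cons
      (LAnKe.bracket (m := m) fun i => FreeLAnKe.of (t.label (.inl i)))
      (fun j => FreeLAnKe.of (t.label (.inr j))) :
        Fin (m + 1) → FreeLAnKe m (Fin (2 * m + 1))) := by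
  rw [combWord, BracketWord.eval]
  congr 1
  funext i
  refine Fin.cases ?_ (fun j => ?_) i <;> simp [BracketWord.eval]

theorem combWord_relabel {m : ℕ} (ρ : Equiv.Perm (Fin (2 * m + 1))) (t : Tableau m) :
    (combWord t).relabel ρ = combWord (ρ • t) := by
  rw [combWord, BracketWord.relabel, combWord]
  congr 1
  funext i
  refine Fin.cases ?_ (fun j => ?_) i <;> simp [BracketWord.relabel, Tableau.label_smul]

theorem rhoComb_rearrange {m : ℕ} (t : Tableau m) (σ : Equiv.Perm (Fin (m + 1)))
    (τ : Equiv.Perm (Fin m)) :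
    rhoComb t = (sgn σ * sgn τ) • rhoComb (t.rearrange (Equiv.sumCongr σ τ)) := by
  refine Subtype.ext ?_
  change (combWord t).eval = (sgn σ * sgn τ) • (combWord _).eval
  let a : Equiv.Perm (Fin (m + 1)) := Equiv.Perm.decomposeFin.symm (0, τ)
  have ha : sgn a = sgn τ := by simp [sgn, a, Equiv.Perm.decomposeFin.symm_sign]
  rw [combWord_eval, combWord_eval,
    LAnKe.antisymm (m := m) (fun i => FreeLAnKe.of (t.label (.inl i))) σ,
    LAnKe.antisymm (m := m) (Fin.cons _ _ : Fin (m + 1) → FreeLAnKe m (Fin (2 * m + 1))) a, ha]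
  have e : (Fin.cons (sgn σ • LAnKe.bracket (m := m)
        ((fun i => FreeLAnKe.of (t.label (.inl i))) ∘ σ))
      (fun j => FreeLAnKe.of (t.label (.inr j))) : Fin (m + 1) → FreeLAnKe m (Fin (2 * m + 1))) ∘ a =
      Fin.cons (sgn σ • LAnKe.bracket (m := m)
        (fun i => FreeLAnKe.of ((t.rearrange (Equiv.sumCongr σ τ)).label (.inl i))))
      (fun j => FreeLAnKe.of ((t.rearrange (Equiv.sumCongr σ τ)).label (.inr j))) := by
    funext i
    refine Fin.cases ?_ (fun j => ?_) i
    · simp [a]; rfl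
    · simp [a]; rfl
  rw [e, MultilinearMap.cons_smul, smul_smul, mul_comm (sgn τ)]

/-- The canonical map `V_{n,3} → ρ_{n,3}` that reads a comb in the free LAnKe. -/
noncomputable def combToRho (m : ℕ) : (combRep m).IntertwiningMap (rho m) where
  toLinearMap := combLift rhoComb rhoComb_rearrange
  isIntertwining' ρ := by
    refine combSpace_hom_ext (W := (rhoSub m).toSubmodule) fun t => ?_
    rw [LinearMap.comp_apply, LinearMap.comp_apply, combRep_comb, combLift_comb, combLift_comb]
    refine Subtype.ext ?_
    change (combWord (ρ • t)).eval = FreeLAnKe.rep m _ ρ (combWord t).eval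
    rw [← BracketWord.eval_relabel, combWord_relabel]

theorem phi_comb {m : ℕ} (t : Tableau m) : phi m (comb t) = comb t -
    ∑ i : Fin (m + 1), (-1 : ℂ) ^ (m - (i : ℕ)) • comb (t.rearrange (jacobiPerm i)) := by
  exact combLift_comb (fun t => comb t - combJacobiSum t) sub_combJacobiSum_rearrange t

theorem psiTilde_comb {m : ℕ} (t : Tableau m) : psiTilde m (comb t) = spechtPolytabloid t := by
  exact combLift_comb spechtPolytabloid spechtPolytabloid_rearrange t

theorem combToRho_comb {m : ℕ} (t : Tableau m) : combToRho m (comb t) = rhoComb t := by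
  exact combLift_comb rhoComb rhoComb_rearrange t

/-- The representation `ker φ`, a subrepresentation of `V_{n,3}`. -/
noncomputable abbrev kerPhi (m : ℕ) :
    Representation ℂ (Equiv.Perm (Fin (2 * m + 1))) (phi m).ker.toSubmodule :=
  (phi m).ker.toRepresentation

/-! Up to sign, a comb is determined by the set of its outer entries. Hence `V_{n,3}` is the space
of functions on the `m`-subsets of `[2m+1]`, twisted by the sign. In the Jacobi sum the signs of the
rearrangements combine with the coefficients to the constant `(-1)^m`, so `φ` becomes `1 - (-1)^m
D`, where `D` is the adjacency operator of the odd graph, whose edges join disjoint `m`-sets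
(`combCoord_phi`). Inclusion-exclusion and a double count identify the eigenspace of `D` for
`(-1)^m` with the primitive functions, those whose sums over the `m`-sets containing any given
smaller set vanish (`Slice.primitive_iff`). They form the kernel of the surjection `Slice.down` onto
the functions on `(m-1)`-sets, and the difference of the two binomial coefficients is a Catalan
number.

The coefficient of `Ψ̃ v` at a row tabloid `{s}` is, up to sign, the pairing of the coordinates of
`v` with `s.rowVector`. This vector is primitive and `D` is symmetric, so `Ψ̃` kills `im φ`
(`psiTilde_phi`). Conversely, if `f` is primitive, summing its pairings over all permutations of the
first column of `s` gives a positive multiple of the value of `f` at the second column of `s`; so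
`Ψ̃` is injective on `ker φ` (`eq_zero_of_phi_of_psiTilde`). Hence `ker φ` and `im φ` meet in `0`,
rank-nullity makes them complementary, and the surjection `Ψ̃` restricts to an isomorphism on `ker
φ`.

The canonical map to `ρ_{n,3}` is onto because a multilinear word with two brackets is a comb up to
sign. Its kernel contains `im φ` by the Jacobi identity. For the reverse inclusion one needs a LAnKe
in which the combs satisfy no further relation: a nilpotent model with three layers, the last being
`V_{n,3} / im φ`. The free LAnKe maps to it, and a comb goes to `m! (m+1)!` times its class. -/

/-! ### Inclusion-exclusion for families of finite sets. -/

/-- The sum of the coefficients `f i` over the members `Y i ⊇ S` of a family of finite sets. -/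
noncomputable def upSum {ι α : Type*} [Fintype ι] [DecidableEq α] (Y : ι → Finset α) (f : ι → ℂ)
    (S : Finset α) : ℂ := ∑ i, if S ⊆ Y i then f i else 0

section upSum

variable {ι α : Type*} [Fintype ι] [Fintype α] [DecidableEq α] (Y : ι → Finset α) (f : ι → ℂ)

/-- Only the subsets of `S ∩ T` contribute, and their alternating sum is zero unless `S ∩ T` is
empty. -/
theorem sum_powerset_neg_one_pow_card_ite_subset (S T : Finset α) :
    ∑ R ∈ S.powerset, (-1 : ℂ) ^ R.card * (if R ⊆ T then 1 else 0) =
      if S ⊆ Tᶜ then 1 else 0 := by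
  have h1 : S.powerset.filter (· ⊆ T) = (S ∩ T).powerset := by
    ext R; rw [Finset.mem_filter, Finset.mem_powerset, Finset.mem_powerset, Finset.subset_inter_iff]
  have h2 : (S ⊆ Tᶜ) ↔ S ∩ T = ∅ := by
    rw [Finset.subset_compl_iff_disjoint_right, Finset.disjoint_iff_inter_eq_empty]
  simp only [mul_ite, mul_one, mul_zero]
  rw [← Finset.sum_filter, h1]
  have := congrArg (Int.cast : ℤ → ℂ) (Finset.sum_powerset_neg_one_pow_card (x := S ∩ T))
  push_cast at this
  rw [this]
  simp [h2]

/-- Inclusion-exclusion. -/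
theorem upSum_compl (S : Finset α) : upSum (fun i => (Y i)ᶜ) f S =
    ∑ R ∈ S.powerset, (-1 : ℂ) ^ R.card * upSum Y f R := by
  simp only [upSum, Finset.mul_sum]
  rw [Finset.sum_comm]
  refine Finset.sum_congr rfl fun i _ => ?_
  have := congrArg (· * f i) (sum_powerset_neg_one_pow_card_ite_subset S (Y i))
  simp only [Finset.sum_mul] at this
  simpa [ite_mul, mul_ite, mul_assoc] using this.symm

/-- Double count: a member containing `S` has `k - |S|` further points, and each of them occurs once
as `z`. -/
theorem sum_upSum_insert {k : ℕ} (hY : ∀ i, (Y i).card = k) (S : Finset α) :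
    ∑ z ∈ Sᶜ, upSum Y f (insert z S) = ((k : ℂ) - S.card) * upSum Y f S := by
  simp only [upSum, Finset.mul_sum]
  rw [Finset.sum_comm]
  refine Finset.sum_congr rfl fun i _ => ?_
  by_cases h : S ⊆ Y i
  · have h1 : Sᶜ.filter (fun z => insert z S ⊆ Y i) = Y i \ S := by
      ext z
      simp [Finset.insert_subset_iff, h, and_comm]
    rw [← Finset.sum_filter, h1, Finset.sum_const, Finset.card_sdiff_of_subset h, hY, if_pos h,
      nsmul_eq_mul, Nat.cast_sub (by rw [← hY i]; exact Finset.card_le_card h)]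
  · simp [Finset.insert_subset_iff, h]

/-- Descent on the size of `S`: the double count expresses `(k - |S|)` times the sum at `S` by sums
at sets with one more point, and the factor is nonzero because `|S| < r ≤ k`. -/
theorem upSum_eq_zero_of_card_le {k r : ℕ} (hY : ∀ i, (Y i).card = k) (hr : r ≤ k)
    (h : ∀ S : Finset α, S.card = r → upSum Y f S = 0) (S : Finset α) (hS : S.card ≤ r) :
    upSum Y f S = 0 := by
  induction hd : r - S.card generalizing S with
  | zero => exact h S (by omega)
  | succ d ih =>
    have h1 := sum_upSum_insert Y f hY S
    rw [Finset.sum_eq_zero fun z hz => ih (insert z S)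
      (by rw [Finset.card_insert_of_notMem (Finset.mem_compl.1 hz)]; omega)
      (by rw [Finset.card_insert_of_notMem (Finset.mem_compl.1 hz)]; omega)] at h1
    refine (mul_eq_zero.1 h1.symm).resolve_left ?_
    refine sub_ne_zero.2 ?_
    exact_mod_cast (by omega : k ≠ S.card)

theorem upSum_compl_of_forall_ssubset (S : Finset α)
    (h : ∀ R, R ⊂ S → upSum Y f R = 0) :
    upSum (fun i => (Y i)ᶜ) f S = (-1 : ℂ) ^ S.card * upSum Y f S := by
  rw [upSum_compl]
  refine Finset.sum_eq_single_of_mem S (Finset.mem_powerset_self S) fun R hR hne => ?_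
  rw [h R ((Finset.mem_powerset.1 hR).ssubset_of_ne hne), mul_zero]

/-- The members of the family that meet `T` exactly in `S`. -/
theorem sum_ite_inter_eq (S T : Finset α) (hST : S ⊆ T) (h : ∀ R, R ⊂ T → upSum Y f R = 0) :
    (∑ i, if Y i ∩ T = S then f i else 0) = (-1 : ℂ) ^ (T \ S).card * upSum Y f T := by
  -- Discarding the members that do not contain `S` turns the sum at `P` into the sum at `S ∪ P`, so
  -- inclusion-exclusion is needed only on `T \ S`.
  have key : ∀ P, upSum Y (fun i => if S ⊆ Y i then f i else 0) P = upSum Y f (S ∪ P) := by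
    intro P
    refine Finset.sum_congr rfl fun i _ => ?_
    simp only [Finset.union_subset_iff]
    by_cases h1 : S ⊆ Y i <;> by_cases h2 : P ⊆ Y i <;> simp [h1, h2]
  have h1 := upSum_compl_of_forall_ssubset Y (fun i => if S ⊆ Y i then f i else 0) (T \ S)
    fun R hR => by
      rw [key]
      refine h _ ⟨Finset.union_subset hST (hR.1.trans Finset.sdiff_subset), fun hc => hR.2 ?_⟩
      intro x hx
      have := Finset.mem_sdiff.1 hx
      exact (Finset.mem_union.1 (hc this.1)).resolve_left this.2
  rw [key, Finset.union_sdiff_of_subset hST] at h1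
  rw [← h1]
  refine Finset.sum_congr rfl fun i _ => ?_
  have h2 : Y i ∩ T = S ↔ T \ S ⊆ (Y i)ᶜ ∧ S ⊆ Y i := by
    constructor
    · rintro rfl
      refine ⟨fun x hx => ?_, Finset.inter_subset_left⟩
      simp only [Finset.mem_sdiff, Finset.mem_inter, not_and, Finset.mem_compl] at hx ⊢
      tauto
    · rintro ⟨h3, h4⟩
      ext x
      have h3 := @h3 x
      have h4 := @h4 x
      have h5 := @hST x
      simp only [Finset.mem_sdiff, Finset.mem_inter, Finset.mem_compl] at *
      tauto
  by_cases h3 : T \ S ⊆ (Y i)ᶜ <;> by_cases h4 : S ⊆ Y i <;> simp [h2, h3, h4]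

end upSum

/-! ### The odd graph and its primitive functions. -/

/-- The `m`-subsets of `Fin (2 * m + 1)`. -/
abbrev Slice (m : ℕ) : Type := {Y : Finset (Fin (2 * m + 1)) // Y.card = m}

namespace Slice

variable {m : ℕ}

theorem card_compl_val (Y : Slice m) : (Y : Finset (Fin (2 * m + 1)))ᶜ.card = m + 1 := by
  rw [Finset.card_compl, Fintype.card_fin, Y.2]; omega

/-- The adjacency operator of disjointness (of the odd graph). -/
noncomputable def disjSum (m : ℕ) : (Slice m → ℂ) →ₗ[ℂ] (Slice m → ℂ) where
  toFun f Y := upSum (fun i : Slice m => (i : Finset (Fin (2 * m + 1)))ᶜ) f Y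
  map_add' f g := by
    funext Y
    simp only [upSum, Pi.add_apply, ← Finset.sum_add_distrib]
    exact Finset.sum_congr rfl fun i _ => by split_ifs <;> simp
  map_smul' c f := by
    funext Y
    simp only [upSum, Pi.smul_apply, RingHom.id_apply, smul_eq_mul, Finset.mul_sum]
    exact Finset.sum_congr rfl fun i _ => by split_ifs <;> simp

theorem disjSum_apply (f : Slice m → ℂ) (Y : Slice m) :
    disjSum m f Y = upSum (fun i : Slice m => (i : Finset (Fin (2 * m + 1)))ᶜ) f Y := rfl

theorem upSum_val (f : Slice m → ℂ) (Y : Slice m) :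
    upSum (fun i : Slice m => (i : Finset (Fin (2 * m + 1)))) f Y = f Y := by
  unfold upSum
  rw [Finset.sum_eq_single_of_mem Y (Finset.mem_univ _)]
  · simp
  · intro i _ hne
    refine if_neg fun hs => hne ?_
    exact (Subtype.ext (Finset.eq_of_subset_of_card_le hs (by rw [i.2, Y.2]))).symm

/-- The functions all of whose sums over the `m`-sets containing a smaller set vanish. -/
def Primitive (f : Slice m → ℂ) : Prop :=
  ∀ S : Finset (Fin (2 * m + 1)), S.card < m →
    upSum (fun i : Slice m => (i : Finset (Fin (2 * m + 1)))) f S = 0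

/-- In the inclusion-exclusion for the sets disjoint from `Y`, every term vanishes except the one of
`Y` itself, which is `(-1)^m f Y`. -/
theorem Primitive.disjSum_eq {f : Slice m → ℂ} (hf : Primitive f) :
    disjSum m f = (-1 : ℂ) ^ m • f := by
  funext Y
  rw [disjSum_apply, upSum_compl_of_forall_ssubset, upSum_val, Y.2]
  · rfl
  · intro R hR
    exact hf R ((Finset.card_lt_card hR).trans_eq Y.2)

/-- Disjointness is a symmetric relation, so the operator is self-adjoint for the bilinear pairing.
-/
theorem sum_disjSum_mul (f g : Slice m → ℂ) :
    ∑ Y, f Y * disjSum m g Y = ∑ Y, disjSum m f Y * g Y := by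
  simp only [disjSum_apply, upSum, Finset.mul_sum, Finset.sum_mul]
  rw [Finset.sum_comm]
  refine Finset.sum_congr rfl fun Y _ => Finset.sum_congr rfl fun Z _ => ?_
  have : (Z : Finset (Fin (2 * m + 1))) ⊆ (Y : Finset (Fin (2 * m + 1)))ᶜ ↔
      (Y : Finset (Fin (2 * m + 1))) ⊆ (Z : Finset (Fin (2 * m + 1)))ᶜ := by
    rw [Finset.subset_compl_iff_disjoint_right, Finset.subset_compl_iff_disjoint_right,
      disjoint_comm]
  simp only [this, mul_ite, ite_mul, mul_zero, zero_mul]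

theorem sum_ite_subset_compl_eq (S : Finset (Fin (2 * m + 1))) (Z : Slice m) :
    (∑ Y : Slice m, if S ⊆ Y ∧ (Y : Finset (Fin (2 * m + 1))) ⊆ (Z : Finset _)ᶜ
      then (1 : ℂ) else 0)
      = if S ⊆ (Z : Finset _)ᶜ then (m : ℂ) + 1 - S.card else 0 := by
  split_ifs with hS
  · have hc : ((Z : Finset (Fin (2 * m + 1)))ᶜ \ S).card = m + 1 - S.card := by
      rw [Finset.card_sdiff_of_subset hS, card_compl_val]
    have hle : S.card ≤ m + 1 := by rw [← card_compl_val Z]; exact Finset.card_le_card hS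
    have : (m : ℂ) + 1 - S.card = (((Z : Finset (Fin (2 * m + 1)))ᶜ \ S).card : ℂ) := by
      rw [hc, Nat.cast_sub hle]; push_cast; ring
    rw [this, ← Finset.sum_filter, Finset.sum_const, nsmul_eq_mul, mul_one]
    congr 1
    symm
    -- The complement of `Z` has `m + 1` points, so an `m`-set between `S` and it arises by removing
    -- one point outside `S`.
    refine Finset.card_bij (fun z hz => ⟨(Z : Finset _)ᶜ.erase z, by
      rw [Finset.card_erase_of_mem (Finset.mem_sdiff.1 hz).1, card_compl_val]; rfl⟩) ?_ ?_ ?_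
    · intro z hz
      rw [Finset.mem_filter_univ]
      refine ⟨fun x hx => Finset.mem_erase.2 ⟨?_, hS hx⟩, Finset.erase_subset _ _⟩
      rintro rfl
      exact (Finset.mem_sdiff.1 hz).2 hx
    · intro z hz w hw h
      exact Finset.erase_injOn _ (Finset.mem_sdiff.1 hz).1 (Finset.mem_sdiff.1 hw).1
        (congrArg Subtype.val h)
    · intro Y hY
      rw [Finset.mem_filter_univ] at hY
      obtain ⟨z, hz⟩ : ∃ z, (Z : Finset (Fin (2 * m + 1)))ᶜ \ Y = {z} := by
        rw [← Finset.card_eq_one, Finset.card_sdiff_of_subset hY.2, card_compl_val, Y.2]; omega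
      have hz' := Finset.mem_sdiff.1 (hz ▸ Finset.mem_singleton_self z : z ∈ _ \ _)
      refine ⟨z, Finset.mem_sdiff.2 ⟨hz'.1, fun h => hz'.2 (hY.1 h)⟩, Subtype.ext ?_⟩
      change (Z : Finset _)ᶜ.erase z = Y
      rw [← Finset.sdiff_singleton_eq_erase, ← hz, Finset.sdiff_sdiff_eq_self hY.2]
  · refine Finset.sum_eq_zero fun Y _ => if_neg fun h => hS (h.1.trans h.2)

theorem upSum_disjSum (f : Slice m → ℂ) (S : Finset (Fin (2 * m + 1))) :
    upSum (fun i : Slice m => (i : Finset (Fin (2 * m + 1)))) (disjSum m f) S =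
      ((m : ℂ) + 1 - S.card) *
        upSum (fun i : Slice m => (i : Finset (Fin (2 * m + 1)))ᶜ) f S := by
  have h1 : upSum (fun i : Slice m => (i : Finset (Fin (2 * m + 1)))) (disjSum m f) S =
      ∑ Z : Slice m, (∑ Y : Slice m, if S ⊆ Y ∧ (Y : Finset (Fin (2 * m + 1))) ⊆ (Z : Finset _)ᶜ
        then (1 : ℂ) else 0) * f Z := by
    simp only [upSum, disjSum_apply, Finset.sum_mul]
    rw [Finset.sum_comm]
    refine Finset.sum_congr rfl fun Y _ => ?_
    by_cases h : S ⊆ Y <;> simp [h]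
  rw [h1, upSum, Finset.mul_sum]
  refine Finset.sum_congr rfl fun Z _ => ?_
  rw [sum_ite_subset_compl_eq]
  split_ifs <;> simp

/-- Conversely, let `f` be an eigenvector and argue by induction on `|S|`. Once the sums at proper
subsets of `S` vanish, the sum of `D f` at `S` is `(m + 1 - |S|) (-1)^|S|` times that of `f`, while
the eigenvalue equation makes it `(-1)^m` times that of `f`. -/
theorem primitive_iff (f : Slice m → ℂ) : Primitive f ↔ disjSum m f = (-1 : ℂ) ^ m • f := by
  refine ⟨Primitive.disjSum_eq, fun hf S hS => ?_⟩
  induction hs : S.card using Nat.strong_induction_on generalizing S with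
  | _ s ih =>
    have h1 := upSum_disjSum f S
    rw [upSum_compl_of_forall_ssubset _ _ _ fun R hR =>
      ih R.card (hs ▸ Finset.card_lt_card hR) R ((Finset.card_lt_card hR).trans hS) rfl, hf] at h1
    have h2 : upSum (fun i : Slice m => (i : Finset (Fin (2 * m + 1)))) ((-1 : ℂ) ^ m • f) S =
        (-1 : ℂ) ^ m * upSum (fun i : Slice m => (i : Finset (Fin (2 * m + 1)))) f S := by
      simp only [upSum, Finset.mul_sum, Pi.smul_apply, smul_eq_mul, mul_ite, mul_zero]
    rw [h2, ← sub_eq_zero, ← mul_assoc, ← sub_mul] at h1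
    refine (mul_eq_zero.1 h1).resolve_left fun h3 => ?_
    have h4 : ((-1 : ℤ) ^ m - (m + 1 - S.card) * (-1) ^ S.card) = 0 := by exact_mod_cast h3
    -- As `|S| < m`, the factor is at least `2` and cannot balance the signs.
    have h5 : (2 : ℤ) ≤ m + 1 - S.card := by omega
    rcases neg_one_pow_eq_or ℤ m with h6 | h6 <;>
      rcases neg_one_pow_eq_or ℤ S.card with h7 | h7 <;> rw [h6, h7] at h4 <;> linarith

/-- Summation of a function on the `m`-sets over those containing a given `(m - 1)`-set. -/
noncomputable def down (m : ℕ) : (Slice m → ℂ) →ₗ[ℂ]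
    ({Z : Finset (Fin (2 * m + 1)) // Z.card + 1 = m} → ℂ) where
  toFun f Z := upSum (fun i : Slice m => (i : Finset (Fin (2 * m + 1)))) f Z
  map_add' f g := by
    funext Y
    simp only [upSum, Pi.add_apply, ← Finset.sum_add_distrib]
    exact Finset.sum_congr rfl fun i _ => by split_ifs <;> simp
  map_smul' c f := by
    funext Y
    simp only [upSum, Pi.smul_apply, RingHom.id_apply, smul_eq_mul, Finset.mul_sum]
    exact Finset.sum_congr rfl fun i _ => by split_ifs <;> simp

theorem primitive_iff_mem_ker_down (f : Slice m → ℂ) :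
    Primitive f ↔ f ∈ LinearMap.ker (down m) := by
  rw [LinearMap.mem_ker]
  constructor
  · intro h
    funext Z
    exact h Z (by have := Z.2; omega)
  · intro h S hS
    refine upSum_eq_zero_of_card_le (k := m) (r := m - 1) _ f (fun i => i.2) (by omega)
      (fun T hT => ?_) S (by omega)
    exact congrFun h ⟨T, by omega⟩

/-- Dually, a function `g` on the `(m-1)`-sets whose sum over the subsets of every `m`-set vanishes
must be zero. Passing to complements makes this a statement about sums over supersets, to which
descent applies; inclusion-exclusion then recovers `g`. -/
theorem down_surjective (m : ℕ) : Function.Surjective (down m) := by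
  rw [← LinearMap.dualMap_injective_iff, injective_iff_map_eq_zero]
  intro ψ hψ
  set g : {Z : Finset (Fin (2 * m + 1)) // Z.card + 1 = m} → ℂ := fun Z => ψ (Pi.single Z 1)
  have hg : ∀ S : Finset (Fin (2 * m + 1)), S.card = m + 1 →
      upSum (fun Z : {Z : Finset (Fin (2 * m + 1)) // Z.card + 1 = m} =>
        (Z : Finset (Fin (2 * m + 1)))ᶜ) g S = 0 := by
    intro S hS
    let Y : Slice m := ⟨Sᶜ, by rw [Finset.card_compl, hS, Fintype.card_fin]; omega⟩
    have h1 : ψ (down m (Pi.single Y 1)) = 0 := LinearMap.congr_fun hψ (Pi.single Y 1)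
    have h2 : down m (Pi.single Y 1) = ∑ Z : {Z : Finset (Fin (2 * m + 1)) // Z.card + 1 = m},
        (if S ⊆ (Z : Finset (Fin (2 * m + 1)))ᶜ then (1 : ℂ) else 0) • Pi.single Z 1 := by
      funext Z
      rw [Finset.sum_apply, Finset.sum_eq_single_of_mem (a := Z) (h := Finset.mem_univ _)]
      · change upSum (fun i : Slice m => (i : Finset (Fin (2 * m + 1)))) _ _ = _
        unfold upSum
        rw [Finset.sum_eq_single_of_mem Y (Finset.mem_univ _)]
        · simp only [Pi.single_eq_same, Pi.smul_apply, smul_eq_mul, mul_one]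
          have : (Z : Finset (Fin (2 * m + 1))) ⊆ Sᶜ ↔ S ⊆ (Z : Finset (Fin (2 * m + 1)))ᶜ := by
            rw [Finset.subset_compl_comm]
          simp only [Y, this]
        · intro i _ hi
          simp [Pi.single_eq_of_ne hi]
      · intro Z' _ hZ'
        simp only [Pi.smul_apply]
        rw [Pi.single_eq_of_ne hZ'.symm, smul_zero]
    rw [h2, map_sum] at h1
    rw [← h1]
    refine Finset.sum_congr rfl fun Z _ => ?_
    rw [map_smul]
    split_ifs <;> simp [g]
  -- The complements of the `(m-1)`-sets have `m + 2` points, and the hypothesis concerns sets of `m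
  -- + 1` points.
  have hg' := upSum_eq_zero_of_card_le (k := m + 2) (r := m + 1) _ g (fun Z => by
    rw [Finset.card_compl, Fintype.card_fin]; have := Z.2; omega) (by omega) hg
  have h0 : ∀ Z, g Z = 0 := by
    intro Z
    -- Complementing a second time leaves only `g Z` on the left, while the right side involves only
    -- sets of at most `m - 1` points.
    have h1 := upSum_compl (fun Z : {Z : Finset (Fin (2 * m + 1)) // Z.card + 1 = m} =>
      (Z : Finset (Fin (2 * m + 1)))ᶜ) g Z
    rw [Finset.sum_eq_zero fun R hR => by
      rw [hg' R (by have := Finset.card_le_card (Finset.mem_powerset.1 hR); have := Z.2; omega),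
        mul_zero]] at h1
    simp only [compl_compl, upSum] at h1
    rw [Finset.sum_eq_single_of_mem Z (Finset.mem_univ _)] at h1
    · simpa using h1
    · intro Z' _ hne
      refine if_neg fun hs => hne ?_
      exact (Subtype.ext (Finset.eq_of_subset_of_card_le hs
        (by have := Z.2; have := Z'.2; omega))).symm
  refine LinearMap.pi_ext' fun Z => LinearMap.ext_ring ?_
  simpa [g] using h0 Z

/-- Here `m = k + 1`, and the difference of the dimensions is written additively to avoid truncated
subtraction. Both sides agree after multiplication by `k + 3`. -/
theorem choose_sub_choose_eq_catalan (k : ℕ) :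
    (2 * k + 3).choose (k + 1) = catalan (k + 2) + (2 * k + 3).choose k := by
  have h1 := Nat.choose_succ_right_eq (2 * k + 3) k
  have h2 := succ_mul_catalan_eq_centralBinom (k + 2)
  have h3 : Nat.centralBinom (k + 2) = 2 * (2 * k + 3).choose (k + 1) := by
    have h : (2 * k + 3).choose (k + 1 + 1) = (2 * k + 3).choose (k + 1) :=
      Nat.choose_symm_half (k + 1)
    rw [Nat.centralBinom_eq_two_mul_choose, show 2 * (k + 2) = 2 * k + 3 + 1 by ring,
      Nat.choose_succ_succ, Nat.succ_eq_add_one, h]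
    ring
  have h4 : 2 * k + 3 - k = k + 3 := by omega
  rw [h4] at h1
  rw [h3] at h2
  refine Nat.eq_of_mul_eq_mul_left (Nat.succ_pos (k + 2)) ?_
  nlinarith

theorem finrank_ker_down (m : ℕ) :
    Module.finrank ℂ (LinearMap.ker (down m)) = catalan (m + 1) := by
  have h := (down m).finrank_range_add_finrank_ker
  rw [LinearMap.range_eq_top.2 (down_surjective m), finrank_top, Module.finrank_pi,
    Module.finrank_pi, Fintype.card_finset_len, Fintype.card_fin] at h
  rcases m with - | k
  -- For `m = 0` the condition `Z.card + 1 = m` has no solution, whereas `Z.card = m - 1` would have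
  -- admitted the empty set.
  · have : IsEmpty {Z : Finset (Fin (2 * 0 + 1)) // Z.card + 1 = 0} := ⟨fun Z => by
      have := Z.2; omega⟩
    simpa using h
  · have h1 : Fintype.card {Z : Finset (Fin (2 * (k + 1) + 1)) // Z.card + 1 = k + 1} =
        (2 * k + 3).choose k := by
      simp only [Nat.add_right_cancel_iff]
      rw [Fintype.card_finset_len, Fintype.card_fin]
      rfl
    rw [h1] at h
    have h2 := choose_sub_choose_eq_catalan k
    change _ = (2 * k + 3).choose (k + 1) at h
    change _ = catalan (k + 2)
    rw [h2] at h
    linarith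

end Slice

/-! ### Signs of tableaux and coordinates on the comb space. -/

theorem sgn_mul_self {α : Type*} [Fintype α] [DecidableEq α] (σ : Equiv.Perm α) :
    sgn σ * sgn σ = 1 := by
  rcases Int.units_eq_one_or (Equiv.Perm.sign σ) with h | h <;> simp [sgn, h]

theorem sgn_mul {α : Type*} [Fintype α] [DecidableEq α] (σ τ : Equiv.Perm α) :
    sgn (σ * τ) = sgn σ * sgn τ := by
  simp [sgn]

theorem sgn_sumCongr {m : ℕ} (σ : Equiv.Perm (Fin (m + 1))) (τ : Equiv.Perm (Fin m)) :
    sgn (Equiv.sumCongr σ τ : Equiv.Perm (Cell m)) = sgn σ * sgn τ := by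
  have h : Equiv.Perm.sign (Equiv.sumCongr σ τ : Equiv.Perm (Cell m)) =
    Equiv.Perm.sign σ * Equiv.Perm.sign τ := Equiv.Perm.sign_sumCongr σ τ
  simp [sgn, h]

namespace Tableau

variable {m : ℕ}

@[ext]
theorem ext {t s : Tableau m} (h : ∀ c, t.label c = s.label c) : t = s := Equiv.ext h

theorem label_cell (t : Tableau m) (a : Fin (2 * m + 1)) : t.label (t.cell a) = a :=
  t.right_inv a

theorem cell_label (t : Tableau m) (c : Cell m) : t.cell (t.label c) = c := t.left_inv c

theorem label_injective (t : Tableau m) : Function.Injective t.label :=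
  Function.LeftInverse.injective t.cell_label

theorem cell_injective (t : Tableau m) : Function.Injective t.cell :=
  Function.LeftInverse.injective t.label_cell

theorem label_rearrange (t : Tableau m) (p : Equiv.Perm (Cell m)) (c : Cell m) :
    (t.rearrange p).label c = t.label (p c) := rfl

theorem rearrange_mul (t : Tableau m) (p q : Equiv.Perm (Cell m)) :
    t.rearrange (p * q) = (t.rearrange p).rearrange q := rfl

noncomputable instance : Fintype (Tableau m) :=
  inferInstanceAs (Fintype (Cell m ≃ Fin (2 * m + 1)))

/-- The tableau with first column `0, …, m` and second column `m + 1, …, 2 m`. -/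
def reference (m : ℕ) : Cell m ≃ Fin (2 * m + 1) :=
  finSumFinEquiv.trans (finCongr (by omega))

/-- The sign of a tableau, relative to a reference tableau. -/
noncomputable def sign (t : Tableau m) : ℂ :=
  sgn (Equiv.trans t (reference m).symm : Equiv.Perm (Cell m))

theorem sign_rearrange (t : Tableau m) (p : Equiv.Perm (Cell m)) :
    (t.rearrange p).sign = sgn p * t.sign := by
  rw [mul_comm]
  exact sgn_mul (Equiv.trans t (reference m).symm : Equiv.Perm (Cell m)) p

theorem smul_eq_rearrange (σ : Equiv.Perm (Fin (2 * m + 1))) (t : Tableau m) :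
    σ • t = t.rearrange ((show Cell m ≃ Fin (2 * m + 1) from t).symm.permCongr σ) := by
  refine ext fun c => ?_
  exact (Equiv.apply_symm_apply (show Cell m ≃ Fin (2 * m + 1) from t) _).symm

theorem sign_smul (σ : Equiv.Perm (Fin (2 * m + 1))) (t : Tableau m) :
    (σ • t).sign = sgn σ * t.sign := by
  rw [smul_eq_rearrange, sign_rearrange, sgn, Equiv.Perm.sign_permCongr]

theorem sign_mul_self (t : Tableau m) : t.sign * t.sign = 1 := sgn_mul_self _

theorem sign_ne_zero (t : Tableau m) : t.sign ≠ 0 := left_ne_zero_of_mul_eq_one t.sign_mul_self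

/-- The set of entries of the second column. -/
def secondColumn (t : Tableau m) : Slice m :=
  ⟨Finset.univ.image fun j => t.label (.inr j), by
    refine (Finset.card_image_of_injective _ (t.label_injective.comp Sum.inr_injective)).trans ?_
    rw [Finset.card_univ, Fintype.card_fin]⟩

theorem mem_secondColumn {t : Tableau m} {a : Fin (2 * m + 1)} :
    a ∈ (t.secondColumn : Finset _) ↔ ∃ j, t.label (.inr j) = a := by
  simp [secondColumn]

theorem label_mem_secondColumn {t : Tableau m} {c : Cell m} :
    t.label c ∈ (t.secondColumn : Finset _) ↔ ∃ j, c = .inr j := by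
  rw [mem_secondColumn]
  exact exists_congr fun j => ⟨fun h => (t.label_injective h).symm, fun h => h ▸ rfl⟩

theorem label_inl_notMem_secondColumn (t : Tableau m) (i : Fin (m + 1)) :
    t.label (.inl i) ∉ (t.secondColumn : Finset _) := by
  simp [label_mem_secondColumn]

theorem mem_secondColumn_iff_col {t : Tableau m} {a : Fin (2 * m + 1)} :
    a ∈ (t.secondColumn : Finset _) ↔ (t.cell a).col = 1 := by
  conv_lhs => rw [← t.label_cell a]
  rw [label_mem_secondColumn]
  rcases t.cell a with c | c <;> simp [Cell.col]

theorem secondColumn_eq_iff {t s : Tableau m} :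
    t.secondColumn = s.secondColumn ↔ ∀ a, (t.cell a).col = (s.cell a).col := by
  rw [Subtype.ext_iff, Finset.ext_iff]
  refine forall_congr' fun a => ?_
  rw [mem_secondColumn_iff_col, mem_secondColumn_iff_col]
  generalize (t.cell a).col = x
  generalize (s.cell a).col = y
  fin_cases x <;> fin_cases y <;> simp

theorem secondColumn_rearrange_sumCongr (t : Tableau m) (σ : Equiv.Perm (Fin (m + 1)))
    (τ : Equiv.Perm (Fin m)) :
    (t.rearrange (Equiv.sumCongr σ τ)).secondColumn = t.secondColumn := by
  refine Subtype.ext (Finset.ext fun a => ?_)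
  rw [mem_secondColumn, mem_secondColumn]
  exact τ.surjective.exists (p := fun j => t.label (.inr j) = a) |>.symm

/-- The permutation of cells carrying one filling to the other preserves the first column, hence
splits into permutations of the two columns. -/
theorem exists_rearrange_of_secondColumn_eq {t s : Tableau m}
    (h : t.secondColumn = s.secondColumn) :
    ∃ (σ : Equiv.Perm (Fin (m + 1))) (τ : Equiv.Perm (Fin m)),
      s = t.rearrange (Equiv.sumCongr σ τ) := by
  let p : Equiv.Perm (Cell m) := Equiv.trans s (Equiv.symm t)
  have hp : ∀ c, t.label (p c) = s.label c := fun c => t.label_cell _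
  have hp' : Set.MapsTo p (Set.range Sum.inl) (Set.range Sum.inl) := by
    rintro _ ⟨i, rfl⟩
    rcases hc : p (.inl i) with c | c
    · exact ⟨c, rfl⟩
    · have h1 := hp (.inl i)
      have h2 := s.label_inl_notMem_secondColumn i
      rw [← h1, hc, ← h] at h2
      exact absurd (label_mem_secondColumn.2 ⟨c, rfl⟩) h2
  obtain ⟨⟨σ, τ⟩, hστ⟩ := Equiv.Perm.mem_sumCongrHom_range_of_perm_mapsTo_inl hp'
  refine ⟨σ, τ, ext fun c => ?_⟩
  rw [← hp, ← hστ]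
  rfl

theorem secondColumn_surjective : Function.Surjective (secondColumn (m := m)) := by
  intro Y
  let e : Cell m ≃ Fin (2 * m + 1) :=
    (Equiv.sumComm _ _).trans <| (Equiv.sumCongr (Finset.equivFinOfCardEq Y.2).symm
      ((Finset.equivFinOfCardEq Y.card_compl_val).symm.trans
        (Equiv.subtypeEquivRight fun _ => Finset.mem_compl))).trans
      (Equiv.sumCompl (· ∈ (Y : Finset (Fin (2 * m + 1)))))
  let t : Tableau m := e
  refine ⟨t, Subtype.ext (Finset.eq_of_subset_of_card_le (fun a ha => ?_) ?_)⟩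
  · obtain ⟨j, rfl⟩ := mem_secondColumn.1 ha
    exact ((Finset.equivFinOfCardEq Y.2).symm j).2
  · rw [Y.2, t.secondColumn.2]

end Tableau

/-- The coordinates of a comb: up to a sign, a comb depends only on its set of outer entries. -/
noncomputable def combCoord (m : ℕ) : CombSpace m →ₗ[ℂ] (Slice m → ℂ) :=
  combLift (fun t => t.sign • Pi.single t.secondColumn 1) fun t σ τ => by
    rw [Tableau.secondColumn_rearrange_sumCongr, Tableau.sign_rearrange, sgn_sumCongr, smul_smul,
      ← mul_assoc, mul_mul_mul_comm, sgn_mul_self, sgn_mul_self, one_mul, one_mul]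

theorem combCoord_comb {m : ℕ} (t : Tableau m) :
    combCoord m (comb t) = t.sign • Pi.single t.secondColumn 1 :=
  combLift_comb _ _ t

/-- The sign of the tableau and the comb change by the same factor under column permutations. The
signed comb is therefore a function of the second column alone, which provides the inverse of
`combCoord`. -/
theorem sign_smul_comb_eq {m : ℕ} {t s : Tableau m} (h : t.secondColumn = s.secondColumn) :
    t.sign • comb t = s.sign • comb s := by
  obtain ⟨σ, τ, rfl⟩ := Tableau.exists_rearrange_of_secondColumn_eq h
  rw [comb_rearrange t σ τ, Tableau.sign_rearrange, sgn_sumCongr, smul_smul, mul_comm]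

theorem combCoord_bijective (m : ℕ) : Function.Bijective (combCoord m) := by
  choose T hT using Tableau.secondColumn_surjective (m := m)
  let G : (Slice m → ℂ) →ₗ[ℂ] CombSpace m :=
    Fintype.linearCombination ℂ fun Y => (T Y).sign • comb (T Y)
  have hG : ∀ Y, G (Pi.single Y 1) = (T Y).sign • comb (T Y) := fun Y => by
    simp [G]
  refine Function.bijective_iff_has_inverse.2 ⟨G, fun v => ?_, fun f => ?_⟩
  · refine LinearMap.congr_fun (f := G ∘ₗ combCoord m) (g := LinearMap.id)
      (combSpace_hom_ext fun t => ?_) v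
    rw [LinearMap.comp_apply, combCoord_comb, map_smul, hG, sign_smul_comb_eq (hT _), smul_smul,
      t.sign_mul_self, one_smul, LinearMap.id_apply]
  · refine LinearMap.congr_fun (f := combCoord m ∘ₗ G) (g := LinearMap.id)
      (LinearMap.pi_ext' fun Y => LinearMap.ext_ring ?_) f
    simp only [LinearMap.comp_apply, LinearMap.single_apply]
    rw [hG, map_smul, combCoord_comb, hT, smul_smul, Tableau.sign_mul_self, one_smul]
    rfl

/-! ### Exchanging the entries of rows -/

namespace Tableau

variable {m : ℕ}

/-- Exchange the two cells in each of the rows belonging to `R`. -/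
def swapRowsFun (R : Finset (Fin m)) : Cell m → Cell m :=
  Sum.elim
    (Fin.lastCases (.inl (Fin.last m)) fun j => if j ∈ R then .inr j else .inl j.castSucc)
    fun j => if j ∈ R then .inl j.castSucc else .inr j

theorem swapRowsFun_inl_last (R : Finset (Fin m)) :
    swapRowsFun R (.inl (Fin.last m)) = .inl (Fin.last m) := by simp [swapRowsFun]

theorem swapRowsFun_inl_castSucc (R : Finset (Fin m)) (j : Fin m) :
    swapRowsFun R (.inl j.castSucc) = if j ∈ R then .inr j else .inl j.castSucc := by
  simp [swapRowsFun]

theorem swapRowsFun_inr (R : Finset (Fin m)) (j : Fin m) :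
    swapRowsFun R (.inr j) = if j ∈ R then .inl j.castSucc else .inr j := rfl

theorem swapRowsFun_involutive (R : Finset (Fin m)) : Function.Involutive (swapRowsFun R) := by
  rintro (i | j)
  · refine Fin.lastCases ?_ (fun j => ?_) i
    · rw [swapRowsFun_inl_last, swapRowsFun_inl_last]
    · rw [swapRowsFun_inl_castSucc]
      split_ifs with h
      · rw [swapRowsFun_inr, if_pos h]
      · rw [swapRowsFun_inl_castSucc, if_neg h]
  · rw [swapRowsFun_inr]
    split_ifs with h
    · rw [swapRowsFun_inl_castSucc, if_pos h]
    · rw [swapRowsFun_inr, if_neg h]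

/-- The permutation of the cells exchanging the two cells in each of the rows belonging to `R`. -/
def swapRows (R : Finset (Fin m)) : Equiv.Perm (Cell m) := (swapRowsFun_involutive R).toPerm _

theorem swapRows_inl_last (R : Finset (Fin m)) :
    swapRows R (.inl (Fin.last m)) = .inl (Fin.last m) := swapRowsFun_inl_last R

theorem swapRows_inl_castSucc (R : Finset (Fin m)) (j : Fin m) :
    swapRows R (.inl j.castSucc) = if j ∈ R then .inr j else .inl j.castSucc :=
  swapRowsFun_inl_castSucc R j

theorem swapRows_inr (R : Finset (Fin m)) (j : Fin m) :
    swapRows R (.inr j) = if j ∈ R then .inl j.castSucc else .inr j := rfl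

theorem swapRows_insert {R : Finset (Fin m)} {j : Fin m} (hj : j ∉ R) :
    swapRows (insert j R) = Equiv.swap (.inl j.castSucc) (.inr j) * swapRows R := by
  refine Equiv.ext ?_
  rintro (i | k)
  · refine Fin.lastCases ?_ (fun k => ?_) i
    · rw [Equiv.Perm.mul_apply, swapRows_inl_last, swapRows_inl_last,
        Equiv.swap_apply_of_ne_of_ne] <;> simp [(Fin.castSucc_lt_last j).ne']
    · rw [Equiv.Perm.mul_apply, swapRows_inl_castSucc, swapRows_inl_castSucc]
      by_cases h : k = j
      · subst h; simp [hj]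
      · by_cases hR : k ∈ R <;> simp [h, hR, Equiv.swap_apply_of_ne_of_ne]
  · rw [Equiv.Perm.mul_apply, swapRows_inr, swapRows_inr]
    by_cases h : k = j
    · subst h; simp [hj]
    · by_cases hR : k ∈ R <;> simp [h, hR, Equiv.swap_apply_of_ne_of_ne]

theorem sgn_swapRows (R : Finset (Fin m)) : sgn (swapRows R) = (-1) ^ R.card := by
  induction R using Finset.induction_on with
  | empty =>
    have : swapRows (∅ : Finset (Fin m)) = 1 := by
      refine Equiv.ext ?_
      rintro (i | k)
      · refine Fin.lastCases ?_ (fun k => ?_) i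
        · exact swapRows_inl_last _
        · exact swapRows_inl_castSucc _ _
      · rfl
    simp [this, sgn]
  | insert j R hj ih =>
    rw [swapRows_insert hj, sgn_mul, ih, Finset.card_insert_of_notMem hj, pow_succ, sgn,
      Equiv.Perm.sign_swap (by simp)]
    simp

theorem swapRows_injective : Function.Injective (swapRows (m := m)) := by
  intro R R' h
  ext j
  have := DFunLike.congr_fun h (.inr j)
  rw [swapRows_inr, swapRows_inr] at this
  by_cases h1 : j ∈ R <;> by_cases h2 : j ∈ R' <;> simp_all

theorem mem_secondColumn_swapRows {t : Tableau m} {R : Finset (Fin m)} {a : Fin (2 * m + 1)} :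
    a ∈ ((t.rearrange (swapRows R)).secondColumn : Finset _) ↔
      (∃ j ∈ R, t.label (.inl j.castSucc) = a) ∨ ∃ j ∉ R, t.label (.inr j) = a := by
  rw [mem_secondColumn]
  simp only [label_rearrange, swapRows_inr]
  constructor
  · rintro ⟨j, hj⟩
    by_cases h : j ∈ R
    · exact .inl ⟨j, h, by rwa [if_pos h] at hj⟩
    · exact .inr ⟨j, h, by rwa [if_neg h] at hj⟩
  · rintro (⟨j, h, hj⟩ | ⟨j, h, hj⟩)
    · exact ⟨j, by rwa [if_pos h]⟩
    · exact ⟨j, by rwa [if_neg h]⟩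

/-- The last row has one cell and every other row has two, so row equivalence amounts to choosing
the rows to be swapped. -/
theorem tabloid_mk_eq_iff {t s : Tableau m} :
    Tabloid.mk t = Tabloid.mk s ↔ ∃ R, t = s.rearrange (swapRows R) := by
  have hrow : Tabloid.mk t = Tabloid.mk s ↔ ∀ c, (s.cell (t.label c)).row = c.row := by
    refine (Quotient.eq (r := rowSetoid m)).trans ⟨fun h c => ?_, fun h a => ?_⟩
    · rw [← h, cell_label]
    · rw [← h, label_cell]
  rw [hrow]
  constructor
  · intro h
    have hcases : ∀ (d : Cell m) (j : Fin m), d.row = j.castSucc →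
        d = .inl j.castSucc ∨ d = .inr j := by
      rintro (i | k) j hd
      · exact .inl (congrArg Sum.inl hd)
      · exact .inr (congrArg Sum.inr (Fin.castSucc_injective _ hd))
    have hinj : Function.Injective fun c => s.cell (t.label c) :=
      s.cell_injective.comp t.label_injective
    -- `R` consists of the rows whose second entry in `t` lies in the first column of `s`.
    refine ⟨Finset.univ.filter fun j => s.cell (t.label (.inr j)) = .inl j.castSucc,
      ext fun c => ?_⟩
    rw [label_rearrange, ← s.label_cell (t.label c)]
    congr 1
    have hc := h c
    rcases c with i | j
    · revert hc
      refine Fin.lastCases (fun hc => ?_) (fun j hc => ?_) i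
      · rw [swapRows_inl_last]
        rcases hd : s.cell (t.label (.inl (Fin.last m))) with k | k
        · rw [hd] at hc; exact congrArg Sum.inl hc
        · rw [hd] at hc; exact absurd hc (Fin.castSucc_lt_last k).ne
      · rw [swapRows_inl_castSucc]
        simp only [Finset.mem_filter_univ]
        have hne : s.cell (t.label (.inl j.castSucc)) ≠ s.cell (t.label (.inr j)) :=
          hinj.ne (by simp)
        rcases hcases _ j (h (.inr j)) with h1 | h1
        · rw [if_pos h1]
          exact (hcases _ j hc).resolve_left fun h2 => hne (h2.trans h1.symm)
        · rw [if_neg (by rw [h1]; simp)]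
          exact (hcases _ j hc).resolve_right fun h2 => hne (h2.trans h1.symm)
    · rw [swapRows_inr]
      simp only [Finset.mem_filter_univ]
      split_ifs with h1
      · exact h1
      · exact (hcases _ j hc).resolve_left h1
  · rintro ⟨R, rfl⟩ c
    rw [label_rearrange, cell_label]
    rcases c with i | j
    · refine Fin.lastCases ?_ (fun j => ?_) i
      · rw [swapRows_inl_last]
      · rw [swapRows_inl_castSucc]
        split_ifs <;> rfl
    · rw [swapRows_inr]
      split_ifs <;> rfl

/-! ### The Jacobi rearrangements -/

/-- This factorization makes the sign computable: the swap of all rows and the cycle through the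
first column each contribute `(-1)^m`, leaving only the sign of the cycle at `i`. -/
theorem jacobiPerm_eq (i : Fin (m + 1)) : jacobiPerm i =
    (Equiv.sumCongr (i.cycleRange⁻¹ * (Fin.last m).cycleRange) 1 : Equiv.Perm (Cell m)) *
      swapRows Finset.univ := by
  refine Equiv.ext ?_
  rintro (k | j)
  · refine Fin.lastCases ?_ (fun k => ?_) k
    · rw [Equiv.Perm.mul_apply, swapRows_inl_last]
      simp [jacobiPerm, Equiv.Perm.inv_def]
    · rw [Equiv.Perm.mul_apply, swapRows_inl_castSucc]
      simp [jacobiPerm]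
  · rw [Equiv.Perm.mul_apply, swapRows_inr, if_pos (Finset.mem_univ _)]
    simp [jacobiPerm, Equiv.Perm.inv_def]

theorem sgn_jacobiPerm (i : Fin (m + 1)) : sgn (jacobiPerm i) = (-1) ^ (i : ℕ) := by
  rw [jacobiPerm_eq, sgn_mul, sgn_sumCongr, sgn_swapRows, sgn_mul]
  simp only [sgn, Equiv.Perm.sign_inv, Fin.sign_cycleRange, Finset.card_univ, Fintype.card_fin]
  simp [mul_assoc, ← mul_pow]

theorem mem_secondColumn_jacobiPerm {t : Tableau m} {i : Fin (m + 1)} {a : Fin (2 * m + 1)} :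
    a ∈ ((t.rearrange (jacobiPerm i)).secondColumn : Finset _) ↔
      ∃ k, k ≠ i ∧ t.label (.inl k) = a := by
  rw [mem_secondColumn]
  constructor
  · rintro ⟨j, rfl⟩
    exact ⟨i.succAbove j, Fin.succAbove_ne i j, rfl⟩
  · rintro ⟨k, hk, rfl⟩
    obtain ⟨j, rfl⟩ := Fin.exists_succAbove_eq hk
    exact ⟨j, rfl⟩

/-- An `m`-set disjoint from the second column lies in the first column, which has `m + 1` entries,
so it omits exactly one `xᵢ`; this `i` names the unique Jacobi term producing it. -/
theorem sum_single_secondColumn_jacobiPerm (t : Tableau m) :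
    ∑ i, Pi.single (t.rearrange (jacobiPerm i)).secondColumn (1 : ℂ) =
      Slice.disjSum m (Pi.single t.secondColumn 1) := by
  funext Y
  have h1 : Slice.disjSum m (Pi.single t.secondColumn 1) Y =
      if (Y : Finset (Fin (2 * m + 1))) ⊆ (t.secondColumn : Finset _)ᶜ then 1 else 0 := by
    rw [Slice.disjSum_apply, upSum, Finset.sum_eq_single_of_mem t.secondColumn (Finset.mem_univ _)]
    · rw [Pi.single_eq_same]
    · intro Z _ hZ
      rw [Pi.single_eq_of_ne hZ, ite_self]
  have hinl : ∀ a, a ∈ (t.secondColumn : Finset _)ᶜ → ∃ k, t.label (.inl k) = a := by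
    intro a ha
    rcases hc : t.cell a with k | j
    · exact ⟨k, by rw [← hc, label_cell]⟩
    · exact absurd (mem_secondColumn.2 ⟨j, by rw [← hc, label_cell]⟩) (Finset.mem_compl.1 ha)
  rw [h1, Finset.sum_apply]
  split_ifs with hY
  · have hlt : (Y : Finset (Fin (2 * m + 1))).card <
        (t.secondColumn : Finset (Fin (2 * m + 1)))ᶜ.card := by
      rw [t.secondColumn.card_compl_val, Y.2]; exact m.lt_succ_self
    obtain ⟨a, ha, haY⟩ := Finset.exists_mem_notMem_of_card_lt_card hlt
    obtain ⟨i, rfl⟩ := hinl a ha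
    have hYi : Y = (t.rearrange (jacobiPerm i)).secondColumn := by
      refine Subtype.ext (Finset.eq_of_subset_of_card_le (fun b hb => ?_)
        ((t.rearrange (jacobiPerm i)).secondColumn.2.trans Y.2.symm).le)
      obtain ⟨k, rfl⟩ := hinl b (hY hb)
      exact mem_secondColumn_jacobiPerm.2 ⟨k, fun h => haY (h ▸ hb), rfl⟩
    rw [Finset.sum_eq_single_of_mem i (Finset.mem_univ _), ← hYi, Pi.single_eq_same]
    intro k _ hk
    refine Pi.single_eq_of_ne (fun h => haY ?_) _
    rw [h]
    exact mem_secondColumn_jacobiPerm.2 ⟨i, hk.symm, rfl⟩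
  · refine Finset.sum_eq_zero fun i _ => Pi.single_eq_of_ne (fun h => hY fun a ha => ?_) _
    rw [h] at ha
    obtain ⟨k, -, rfl⟩ := mem_secondColumn_jacobiPerm.1 ha
    exact Finset.mem_compl.2 (t.label_inl_notMem_secondColumn k)

end Tableau

/-- The sign `(-1)^i` of the `i`-th rearrangement and the coefficient `(-1)^(m-i)` multiply to
`(-1)^m`, so all Jacobi terms enter with the same factor. -/
theorem combCoord_phi {m : ℕ} (v : CombSpace m) : combCoord m (phi m v) =
    combCoord m v - (-1 : ℂ) ^ m • Slice.disjSum m (combCoord m v) := by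
  refine LinearMap.congr_fun (f := combCoord m ∘ₗ (phi m).toLinearMap)
    (g := combCoord m - (-1 : ℂ) ^ m • Slice.disjSum m ∘ₗ combCoord m)
    (combSpace_hom_ext fun t => ?_) v
  change combCoord m (phi m (comb t)) =
    combCoord m (comb t) - (-1 : ℂ) ^ m • Slice.disjSum m (combCoord m (comb t))
  rw [phi_comb, map_sub, map_sum, combCoord_comb, map_smul,
    ← Tableau.sum_single_secondColumn_jacobiPerm, Finset.smul_sum, Finset.smul_sum]
  congr 1
  refine Finset.sum_congr rfl fun i _ => ?_
  rw [map_smul, combCoord_comb, Tableau.sign_rearrange, Tableau.sgn_jacobiPerm, smul_smul,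
    smul_smul, ← mul_assoc, ← pow_add, Nat.sub_add_cancel i.is_le]

theorem phi_eq_zero_iff {m : ℕ} (v : CombSpace m) :
    phi m v = 0 ↔ Slice.Primitive (combCoord m v) := by
  rw [Slice.primitive_iff, ← (combCoord_bijective m).1.eq_iff, map_zero, combCoord_phi, sub_eq_zero]
  have h : (-1 : ℂ) ^ m * (-1) ^ m = 1 := by rw [← mul_pow]; simp
  constructor
  · intro h1
    conv_rhs => rw [h1, smul_smul, h, one_smul]
  · intro h1
    rw [h1, smul_smul, h, one_smul]

/-! ### The Specht module in coordinates -/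

namespace Tableau

variable {m : ℕ}

/-- The coefficients of the polytabloids at the row tabloid of `t`, in coordinates. -/
noncomputable def rowVector (t : Tableau m) : Slice m → ℂ :=
  ∑ R : Finset (Fin m), (-1 : ℂ) ^ R.card • Pi.single (t.rearrange (swapRows R)).secondColumn 1

theorem sum_rowVector_mul (t : Tableau m) (f : Slice m → ℂ) : ∑ Y, t.rowVector Y * f Y =
    ∑ R : Finset (Fin m), (-1 : ℂ) ^ R.card * f (t.rearrange (swapRows R)).secondColumn := by
  simp only [rowVector, Finset.sum_apply, Finset.sum_mul]
  rw [Finset.sum_comm]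
  refine Finset.sum_congr rfl fun R _ => ?_
  rw [Finset.sum_eq_single_of_mem _ (Finset.mem_univ (t.rearrange (swapRows R)).secondColumn)]
  · simp
  · intro Y _ hY
    simp [Pi.single_eq_of_ne hY]

/-- A set `S` with fewer than `m` elements misses one of the first `m` rows of `t`. Swapping that
row does not affect whether `S` lies in the second column, but it reverses the sign, so the terms
cancel in pairs. -/
theorem primitive_rowVector (t : Tableau m) : Slice.Primitive t.rowVector := by
  intro S hS
  have h1 : upSum (fun i : Slice m => (i : Finset (Fin (2 * m + 1)))) t.rowVector S =
      ∑ R : Finset (Fin m), (-1 : ℂ) ^ R.card *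
        (if S ⊆ ((t.rearrange (swapRows R)).secondColumn : Finset _) then 1 else 0) := by
    rw [← sum_rowVector_mul t fun Y => if S ⊆ (Y : Finset _) then 1 else 0]
    simp [upSum]
  rw [h1]
  obtain ⟨j, hj⟩ : ∃ j : Fin m, ∀ a ∈ S, (t.cell a).row ≠ j.castSucc := by
    have h2 : (S.image fun a => (t.cell a).row).card <
        (Finset.univ.map (Fin.castSuccEmb : Fin m ↪ Fin (m + 1))).card := by
      rw [Finset.card_map, Finset.card_univ, Fintype.card_fin]
      exact Finset.card_image_le.trans_lt hS
    obtain ⟨r, hr, hrS⟩ := Finset.exists_mem_notMem_of_card_lt_card h2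
    obtain ⟨j, -, rfl⟩ := Finset.mem_map.1 hr
    exact ⟨j, fun a ha h => hrS (Finset.mem_image.2 ⟨a, ha, h⟩)⟩
  have key : ∀ R : Finset (Fin m), j ∉ R →
      (S ⊆ ((t.rearrange (swapRows R)).secondColumn : Finset _) ↔
        S ⊆ ((t.rearrange (swapRows (insert j R))).secondColumn : Finset _)) := by
    intro R _
    refine forall₂_congr fun a ha => ?_
    rw [mem_secondColumn_swapRows, mem_secondColumn_swapRows]
    have hl : t.label (.inl j.castSucc) ≠ a := fun h => hj a ha (by rw [← h, cell_label]; rfl)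
    have hr : t.label (.inr j) ≠ a := fun h => hj a ha (by rw [← h, cell_label]; rfl)
    refine or_congr ⟨?_, ?_⟩ ⟨?_, ?_⟩
    · rintro ⟨k, hk, h⟩
      exact ⟨k, Finset.mem_insert_of_mem hk, h⟩
    · rintro ⟨k, hk, h⟩
      rcases Finset.mem_insert.1 hk with rfl | hk
      · exact absurd h hl
      · exact ⟨k, hk, h⟩
    · rintro ⟨k, hk, h⟩
      refine ⟨k, fun hk' => ?_, h⟩
      rcases Finset.mem_insert.1 hk' with rfl | hk'
      · exact hr h
      · exact hk hk'
    · rintro ⟨k, hk, h⟩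
      exact ⟨k, fun hk' => hk (Finset.mem_insert_of_mem hk'), h⟩
  rw [← Finset.powerset_univ, ← Finset.insert_erase (Finset.mem_univ j),
    Finset.sum_powerset_insert (Finset.notMem_erase _ _), ← Finset.sum_add_distrib]
  refine Finset.sum_eq_zero fun R hR => ?_
  have hjR : j ∉ R := fun h => Finset.notMem_erase _ _ (Finset.mem_powerset.1 hR h)
  simp only [← key R hjR, Finset.card_insert_of_notMem hjR, pow_succ]
  ring

theorem inColStab_iff {t : Tableau m} {β : Equiv.Perm (Fin (2 * m + 1))} :
    InColStab t β ↔ (β • t).secondColumn = t.secondColumn := by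
  rw [secondColumn_eq_iff]
  constructor
  · intro h a
    rw [cell_smul, ← h (β⁻¹ a)]
    exact congrArg (fun x => (t.cell x).col) (β.apply_symm_apply a)
  · intro h a
    rw [← h (β a), cell_smul]
    exact congrArg (fun x => (t.cell x).col) (β.symm_apply_apply a)

/-- The `β` in `C_t` with `{β t} = {s}` correspond to the sets `R` of rows whose swap gives `s` the
second column of `t`. Comparing signs in `β t = s.rearrange (swapRows R)` gives `sgn β`. -/
theorem polytabloid_apply (t s : Tableau m) :
    polytabloid t (Tabloid.mk s) = s.sign * (t.sign * s.rowVector t.secondColumn) := by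
  classical
  have h1 : polytabloid t (Tabloid.mk s) = ∑ β : Equiv.Perm (Fin (2 * m + 1))
      with InColStab t β ∧ Tabloid.mk (β • t) = Tabloid.mk s, sgn β := by
    rw [polytabloid, Finsupp.finsetSum_apply, ← Finset.filter_filter]
    conv_rhs => rw [Finset.sum_filter]
    refine Finset.sum_congr rfl fun β _ => ?_
    rw [Finsupp.smul_apply, Finsupp.single_apply]
    split_ifs <;> simp
  have h2 : s.rowVector t.secondColumn = ∑ R : Finset (Fin m)
      with (s.rearrange (swapRows R)).secondColumn = t.secondColumn, (-1 : ℂ) ^ R.card := by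
    rw [rowVector, Finset.sum_apply, Finset.sum_filter]
    refine Finset.sum_congr rfl fun R _ => ?_
    rw [Pi.smul_apply, Pi.single_apply]
    simp only [eq_comm]
    split_ifs <;> simp
  rw [h1, h2, Finset.mul_sum, Finset.mul_sum]
  symm
  let b : Finset (Fin m) → Equiv.Perm (Fin (2 * m + 1)) := fun R =>
    Equiv.trans (Equiv.symm t) (s.rearrange (swapRows R))
  have hb : ∀ R, b R • t = s.rearrange (swapRows R) := fun R => ext fun c => by
    rw [label_smul]
    exact congrArg (s.rearrange (swapRows R)).label (t.cell_label c)
  refine Finset.sum_bij (fun R _ => b R) (fun R hR => ?_) (fun R _ R' _ h => ?_)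
    (fun β hβ => ?_) fun R _ => ?_
  · rw [Finset.mem_filter_univ] at hR ⊢
    rw [inColStab_iff, hb]
    exact ⟨hR, tabloid_mk_eq_iff.2 ⟨R, rfl⟩⟩
  · have h3 : s.rearrange (swapRows R) = s.rearrange (swapRows R') := by rw [← hb, ← hb, h]
    refine swapRows_injective (Equiv.ext fun c => s.label_injective ?_)
    rw [← label_rearrange, h3, label_rearrange]
  · rw [Finset.mem_filter_univ, inColStab_iff] at hβ
    obtain ⟨R, hR⟩ := tabloid_mk_eq_iff.1 hβ.2
    refine ⟨R, (Finset.mem_filter_univ _).2 (hR ▸ hβ.1), Equiv.ext fun a => ?_⟩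
    rw [← t.label_cell a, ← label_smul, ← label_smul, hb, hR]
  · have h3 := congrArg sign (hb R)
    rw [sign_smul, sign_rearrange, sgn_swapRows] at h3
    linear_combination (-t.sign) * h3 + sgn (b R) * t.sign_mul_self

end Tableau

theorem psiTilde_apply_mk {m : ℕ} (v : CombSpace m) (s : Tableau m) :
    (psiTilde m v : Tabloid m →₀ ℂ) (Tabloid.mk s) =
      s.sign * ∑ Y, s.rowVector Y * combCoord m v Y := by
  let F : CombSpace m →ₗ[ℂ] ℂ :=
    Finsupp.lapply (Tabloid.mk s) ∘ₗ (spechtSub m).toSubmodule.subtype ∘ₗ (psiTilde m).toLinearMap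
  let G : CombSpace m →ₗ[ℂ] ℂ :=
    s.sign • Fintype.linearCombination ℂ s.rowVector ∘ₗ combCoord m
  have hG : ∀ v, G v = s.sign * ∑ Y, s.rowVector Y * combCoord m v Y := fun v => by
    simp [G, Fintype.linearCombination_apply, mul_comm]
  rw [← hG]
  refine LinearMap.congr_fun (f := F) (g := G) (combSpace_hom_ext fun t => ?_) v
  rw [hG, combCoord_comb]
  change (psiTilde m (comb t) : Tabloid m →₀ ℂ) (Tabloid.mk s) = _
  rw [psiTilde_comb]
  change polytabloid t (Tabloid.mk s) = _
  rw [Tableau.polytabloid_apply, Finset.sum_eq_single_of_mem t.secondColumn (Finset.mem_univ _)]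
  · rw [Pi.smul_apply, Pi.single_eq_same]
    simp [mul_comm]
  · intro Y _ hY
    rw [Pi.smul_apply, Pi.single_eq_of_ne hY]
    simp

theorem psiTilde_eq_zero_iff {m : ℕ} (v : CombSpace m) :
    psiTilde m v = 0 ↔ ∀ s : Tableau m, ∑ Y, s.rowVector Y * combCoord m v Y = 0 := by
  constructor
  · intro h s
    have := psiTilde_apply_mk v s
    rw [h] at this
    exact (mul_eq_zero.1 this.symm).resolve_left s.sign_ne_zero
  · intro h
    refine Subtype.ext (Finsupp.ext fun T => ?_)
    obtain ⟨s, rfl⟩ : ∃ s, Tabloid.mk s = T := Quotient.exists_rep (s := rowSetoid m) T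
    rw [psiTilde_apply_mk, h, mul_zero]
    rfl

/-- Each row vector is an eigenvector of the self-adjoint `D` for `(-1)^m`, hence orthogonal to the
image of `1 - (-1)^m D`. -/
theorem psiTilde_phi {m : ℕ} (v : CombSpace m) : psiTilde m (phi m v) = 0 := by
  rw [psiTilde_eq_zero_iff]
  intro s
  have h : (-1 : ℂ) ^ m * (-1) ^ m = 1 := by rw [← mul_pow]; simp
  have h1 := Slice.sum_disjSum_mul s.rowVector (combCoord m v)
  rw [s.primitive_rowVector.disjSum_eq] at h1
  simp only [Pi.smul_apply, smul_eq_mul, mul_assoc, ← Finset.mul_sum] at h1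
  simp only [combCoord_phi, Pi.sub_apply, Pi.smul_apply, smul_eq_mul, mul_sub,
    Finset.sum_sub_distrib, mul_left_comm _ ((-1 : ℂ) ^ m), ← Finset.mul_sum]
  rw [h1, ← mul_assoc, h, one_mul, sub_self]

/-! ### Nondegeneracy of the pairing on primitive functions. -/

theorem exists_perm_image_eq {β : Type*} [Fintype β] [DecidableEq β] {A Q : Finset β}
    (h : A.card = Q.card) : ∃ g : Equiv.Perm β, A.image g = Q := by
  refine ⟨(Finset.equivOfCardEq h).extendSubtype,
    Finset.eq_of_subset_of_card_le (fun x hx => ?_) ?_⟩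
  · obtain ⟨a, ha, rfl⟩ := Finset.mem_image.1 hx
    exact Equiv.extendSubtype_mem _ _ ha
  · rw [Finset.card_image_of_injective _ (Equiv.injective _), h]

/-- The permutations carrying `A` to `Q` form a coset of the stabilizer of `A`. -/
theorem card_perm_image_eq {β : Type*} [Fintype β] [DecidableEq β] {A Q : Finset β}
    (h : A.card = Q.card) : (Finset.univ.filter fun p : Equiv.Perm β => A.image p = Q).card =
      (Finset.univ.filter fun p : Equiv.Perm β => A.image p = A).card := by
  obtain ⟨g, rfl⟩ := exists_perm_image_eq h
  refine (Finset.card_equiv (Equiv.mulLeft g) fun p => ?_).symm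
  rw [Finset.mem_filter_univ, Finset.mem_filter_univ]
  have h1 : A.image (Equiv.mulLeft g p) = (A.image p).image g := by
    rw [Finset.image_image]; rfl
  rw [h1, (Finset.image_injective g.injective).eq_iff]

namespace Tableau

variable {m : ℕ}

theorem label_inl_injective (t : Tableau m) : Function.Injective fun i => t.label (.inl i) :=
  t.label_injective.comp Sum.inl_injective

theorem label_inr_injective (t : Tableau m) : Function.Injective fun j => t.label (.inr j) :=
  t.label_injective.comp Sum.inr_injective

/-- The number of permutations of the first column that preserve the set of cells in the rows
belonging to `R`. -/
noncomputable def rowStabCard (R : Finset (Fin m)) : ℕ :=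
  (Finset.univ.filter fun p : Equiv.Perm (Fin (m + 1)) =>
    (R.map Fin.castSuccEmb).image p = R.map Fin.castSuccEmb).card

theorem rowStabCard_pos (R : Finset (Fin m)) : 0 < rowStabCard R :=
  Finset.card_pos.2 ⟨1, by simp⟩

/-- The new second column keeps the old entries in the rows outside `R` and receives from the first
column the entries that `p` brings into the rows of `R`; the two requirements are independent. -/
theorem secondColumn_swapRows_eq_iff (s : Tableau m) (R : Finset (Fin m))
    (p : Equiv.Perm (Fin (m + 1))) (Y : Slice m) :
    ((s.rearrange (Equiv.sumCongr p 1)).rearrange (swapRows R)).secondColumn = Y ↔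
      (Y : Finset _) ∩ s.secondColumn = Rᶜ.image (fun j => s.label (.inr j)) ∧
      (R.map Fin.castSuccEmb).image p =
        Finset.univ.filter fun k => s.label (.inl k) ∈ (Y : Finset _) := by
  have hmem : ∀ c, s.label c ∈
      (((s.rearrange (Equiv.sumCongr p 1)).rearrange (swapRows R)).secondColumn : Finset _) ↔
      (∃ j ∈ R, .inl (p j.castSucc) = c) ∨ ∃ j ∉ R, .inr j = c := by
    intro c
    rw [mem_secondColumn_swapRows]
    simp only [label_rearrange, s.label_injective.eq_iff]
    rfl
  rw [Subtype.ext_iff, Finset.ext_iff]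
  have hs : (∀ a, a ∈ (((s.rearrange (Equiv.sumCongr p 1)).rearrange
      (swapRows R)).secondColumn : Finset _) ↔ a ∈ (Y : Finset _)) ↔
      ∀ c, s.label c ∈ (((s.rearrange (Equiv.sumCongr p 1)).rearrange
        (swapRows R)).secondColumn : Finset _) ↔ s.label c ∈ (Y : Finset _) :=
    ⟨fun h c => h _, fun h a => s.label_cell a ▸ h (s.cell a)⟩
  rw [hs, Sum.forall, and_comm]
  refine and_congr ?_ ?_
  · constructor
    · intro h
      ext a
      rw [Finset.mem_inter, mem_secondColumn, Finset.mem_image]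
      constructor
      · rintro ⟨ha, j, rfl⟩
        rw [← h, hmem] at ha
        simp only [reduceCtorEq, and_false, exists_false, false_or, Sum.inr.injEq] at ha
        obtain ⟨k, hk, rfl⟩ := ha
        exact ⟨k, Finset.mem_compl.2 hk, rfl⟩
      · rintro ⟨j, hj, rfl⟩
        exact ⟨(h j).1 ((hmem _).2 (.inr ⟨j, Finset.mem_compl.1 hj, rfl⟩)), j, rfl⟩
    · intro h j
      have h1 : s.label (.inr j) ∈ (Y : Finset _) ↔ j ∉ R := by
        have := Finset.ext_iff.1 h (s.label (.inr j))
        rw [Finset.mem_inter, Finset.mem_image, and_iff_left (mem_secondColumn.2 ⟨j, rfl⟩)] at this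
        simpa [s.label_injective.eq_iff] using this
      rw [hmem, h1]
      simp
  · rw [Finset.ext_iff]
    refine forall_congr' fun k => ?_
    rw [hmem, Finset.mem_filter_univ]
    simp

theorem card_label_inl_mem (s : Tableau m) (R : Finset (Fin m)) (Y : Slice m)
    (h : (Y : Finset _) ∩ s.secondColumn = Rᶜ.image (fun j => s.label (.inr j))) :
    (Finset.univ.filter fun k => s.label (.inl k) ∈ (Y : Finset _)).card = R.card := by
  have h1 : (Y : Finset _) \ s.secondColumn =
      (Finset.univ.filter fun k => s.label (.inl k) ∈ (Y : Finset _)).image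
        fun k => s.label (.inl k) := by
    ext a
    rw [← s.label_cell a, Finset.mem_sdiff, label_mem_secondColumn, Finset.mem_image]
    simp only [Finset.mem_filter_univ, s.label_injective.eq_iff]
    rcases s.cell a with k | k <;> simp
  have h2 := Finset.card_inter_add_card_sdiff (Y : Finset (Fin (2 * m + 1))) s.secondColumn
  rw [h, h1, Finset.card_image_of_injective _ s.label_inr_injective,
    Finset.card_image_of_injective _ s.label_inl_injective,
    Finset.card_compl, Fintype.card_fin, Y.2] at h2
  have h3 := R.card_le_univ
  rw [Fintype.card_fin] at h3
  omega

/-- As `p` varies, the new second column runs over all `m`-sets meeting the old one exactly in the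
entries of the rows outside `R`, each equally often. For primitive `f`, inclusion-exclusion reduces
the sum over these sets to `±f` at the old second column. -/
theorem sum_perm_secondColumn_swapRows {f : Slice m → ℂ} (hf : Slice.Primitive f)
    (s : Tableau m) (R : Finset (Fin m)) :
    ∑ p : Equiv.Perm (Fin (m + 1)),
      f ((s.rearrange (Equiv.sumCongr p 1)).rearrange (swapRows R)).secondColumn =
      rowStabCard R * ((-1 : ℂ) ^ R.card * f s.secondColumn) := by
  set S := Rᶜ.image (fun j => s.label (.inr j)) with hS
  have hST : S ⊆ s.secondColumn := fun a ha => by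
    obtain ⟨j, -, rfl⟩ := Finset.mem_image.1 ha
    exact mem_secondColumn.2 ⟨j, rfl⟩
  have h1 := sum_ite_inter_eq (fun i : Slice m => (i : Finset (Fin (2 * m + 1)))) f S
    s.secondColumn hST fun R hR => hf R ((Finset.card_lt_card hR).trans_eq s.secondColumn.2)
  have h2 : ((s.secondColumn : Finset _) \ S).card = R.card := by
    have h3 := R.card_le_univ
    rw [Finset.card_sdiff_of_subset hST, s.secondColumn.2, hS,
      Finset.card_image_of_injective _ s.label_inr_injective,
      Finset.card_compl, Fintype.card_fin]
    rw [Fintype.card_fin] at h3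
    omega
  rw [h2, Slice.upSum_val] at h1
  rw [← h1, Finset.mul_sum, ← Finset.sum_fiberwise (s := Finset.univ)
    (g := fun p : Equiv.Perm (Fin (m + 1)) =>
      ((s.rearrange (Equiv.sumCongr p 1)).rearrange (swapRows R)).secondColumn)]
  refine Finset.sum_congr rfl fun Y _ => ?_
  rw [Finset.sum_congr rfl (g := fun _ => f Y) fun p hp => by rw [(Finset.mem_filter.1 hp).2],
    Finset.sum_const, nsmul_eq_mul]
  simp only [secondColumn_swapRows_eq_iff]
  by_cases h : (Y : Finset _) ∩ s.secondColumn = S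
  · simp only [← hS, h, true_and, if_true]
    rw [card_perm_image_eq (by rw [card_label_inl_mem s R Y h, Finset.card_map])]
    rfl
  · simp [← hS, h]

/-- After summing over `p`, the two factors `(-1)^|R|` cancel. All sets `R` thus contribute positive
multiples of the same value of `f`, and no cancellation can occur. -/
theorem eq_zero_of_primitive_of_sum_rowVector {f : Slice m → ℂ} (hf : Slice.Primitive f)
    (h : ∀ s : Tableau m, ∑ Y, s.rowVector Y * f Y = 0) : f = 0 := by
  funext Y
  obtain ⟨s, rfl⟩ := secondColumn_surjective Y
  have h1 : ∑ p : Equiv.Perm (Fin (m + 1)), ∑ R : Finset (Fin m), (-1 : ℂ) ^ R.card *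
      f ((s.rearrange (Equiv.sumCongr p 1)).rearrange (swapRows R)).secondColumn = 0 :=
    Finset.sum_eq_zero fun p _ => by rw [← sum_rowVector_mul, h]
  rw [Finset.sum_comm] at h1
  simp only [← Finset.mul_sum, sum_perm_secondColumn_swapRows hf] at h1
  have h2 : ∀ R : Finset (Fin m), (-1 : ℂ) ^ R.card * (rowStabCard R * ((-1 : ℂ) ^ R.card *
      f s.secondColumn)) = rowStabCard R * f s.secondColumn := by
    intro R
    have : (-1 : ℂ) ^ R.card * (-1) ^ R.card = 1 := by rw [← mul_pow]; simp
    linear_combination rowStabCard R * f s.secondColumn * this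
  simp only [h2, ← Finset.sum_mul, ← Nat.cast_sum] at h1
  refine (mul_eq_zero.1 h1).resolve_left (Nat.cast_ne_zero.2 ?_)
  exact (Finset.sum_pos (fun R _ => rowStabCard_pos R) Finset.univ_nonempty).ne'

end Tableau

/-! ### The splitting of the comb space and the dimension of the kernel. -/

theorem eq_zero_of_phi_of_psiTilde {m : ℕ} {v : CombSpace m} (h1 : phi m v = 0)
    (h2 : psiTilde m v = 0) : v = 0 := by
  refine (combCoord_bijective m).1 ?_
  rw [map_zero]
  exact Tableau.eq_zero_of_primitive_of_sum_rowVector ((phi_eq_zero_iff v).1 h1)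
    ((psiTilde_eq_zero_iff v).1 h2)

theorem psiTilde_surjective (m : ℕ) : Function.Surjective (psiTilde m) := by
  rintro ⟨x, hx⟩
  have hx' : x ∈ LinearMap.range
      ((spechtSub m).toSubmodule.subtype ∘ₗ (psiTilde m).toLinearMap) := by
    refine (Submodule.span_le.2 ?_) hx
    rintro _ ⟨t, rfl⟩
    exact ⟨comb t, congrArg Subtype.val (psiTilde_comb t)⟩
  obtain ⟨v, hv⟩ := hx'
  exact ⟨v, Subtype.ext hv⟩

instance (m : ℕ) : FiniteDimensional ℂ (CombSpace m) :=
  Module.Finite.of_injective _ (combCoord_bijective m).1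

/-- `Ψ̃` vanishes on `im φ` and is injective on `ker φ`, so the two are disjoint; rank-nullity does
the rest. -/
theorem isCompl_ker_range_phi (m : ℕ) :
    IsCompl (phi m).ker.toSubmodule (phi m).range.toSubmodule := by
  have hd : Disjoint (phi m).ker.toSubmodule (phi m).range.toSubmodule := by
    rw [Submodule.disjoint_def]
    rintro _ h1 ⟨v, rfl⟩
    exact eq_zero_of_phi_of_psiTilde h1 (psiTilde_phi v)
  refine ⟨hd, codisjoint_iff.2 (Submodule.eq_top_of_finrank_eq ?_)⟩
  have h1 := Submodule.finrank_sup_add_finrank_inf_eq (phi m).ker.toSubmodule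
    (phi m).range.toSubmodule
  have h2 := (phi m).toLinearMap.finrank_range_add_finrank_ker
  rw [hd.eq_bot, finrank_bot] at h1
  have h3 : Module.finrank ℂ (phi m).ker.toSubmodule =
    Module.finrank ℂ (LinearMap.ker (phi m).toLinearMap) := rfl
  have h4 : Module.finrank ℂ (phi m).range.toSubmodule =
    Module.finrank ℂ (LinearMap.range (phi m).toLinearMap) := rfl
  omega

theorem finrank_ker_phi (m : ℕ) :
    Module.finrank ℂ (phi m).ker.toSubmodule = catalan (m + 1) := by
  rw [← Slice.finrank_ker_down]
  let e : CombSpace m ≃ₗ[ℂ] (Slice m → ℂ) := .ofBijective _ (combCoord_bijective m)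
  have h : (phi m).ker.toSubmodule = (LinearMap.ker (Slice.down m)).comap e.toLinearMap := by
    ext v
    rw [Submodule.mem_comap, ← Slice.primitive_iff_mem_ker_down]
    exact phi_eq_zero_iff v
  rw [h]
  exact (e.ofSubmodule' _).finrank_eq

/-! ### A LAnKe built from combs -/

section CombModel

variable {m : ℕ} {W : Type} [AddCommGroup W] [Module ℂ W]

/-- The multilinear extension of a function of tableaux. -/
noncomputable def combSum (w : Tableau m → W) (z : Cell m → Fin (2 * m + 1) → ℂ) : W :=
  ∑ t : Tableau m, (∏ c, z c (t.label c)) • w t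

theorem combSum_comp (w : Tableau m → W) (z : Cell m → Fin (2 * m + 1) → ℂ)
    (p : Equiv.Perm (Cell m)) :
    combSum w (z ∘ p) = combSum (fun t => w (t.rearrange p)) z := by
  let e : Tableau m ≃ Tableau m :=
    ⟨fun t => t.rearrange p, fun t => t.rearrange p⁻¹,
      fun t => (t.rearrange_mul p p⁻¹).symm.trans (by rw [mul_inv_cancel]; rfl),
      fun t => (t.rearrange_mul p⁻¹ p).symm.trans (by rw [inv_mul_cancel]; rfl)⟩
  refine (Equiv.sum_comp e _).symm.trans (Finset.sum_congr rfl fun t _ => ?_)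
  congr 1
  exact Equiv.prod_comp p fun c => z c (t.label c)

theorem combSum_single (w : Tableau m → W) (t : Tableau m) :
    combSum w (fun c => Pi.single (t.label c) 1) = w t := by
  rw [combSum, Finset.sum_eq_single_of_mem t (Finset.mem_univ _)]
  · simp
  · intro s _ hs
    obtain ⟨c, hc⟩ : ∃ c, s.label c ≠ t.label c := by
      by_contra! h
      exact hs (Tableau.ext h)
    rw [Finset.prod_eq_zero (Finset.mem_univ c) (Pi.single_eq_of_ne hc _), zero_smul]

/-- The underlying space of a nilpotent LAnKe: linear combinations of the generators, linear
combinations of the words of length `m + 1`, and a space receiving the combs. -/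
abbrev CombModel (m : ℕ) (W : Type) : Type :=
  (Fin (2 * m + 1) → ℂ) × ((Fin (m + 1) → Fin (2 * m + 1)) → ℂ) × W

namespace CombModel

/-- The coordinate function of the `i`-th argument of the outer bracket of a comb. -/
noncomputable def outerCoord (t : Tableau m) :
    Fin (m + 1) → CombModel m W →ₗ[ℂ] ℂ :=
  Fin.cases (LinearMap.proj (fun i => t.label (.inl i)) ∘ₗ LinearMap.fst ℂ _ _ ∘ₗ
      LinearMap.snd ℂ _ _)
    fun j => LinearMap.proj (t.label (.inr j)) ∘ₗ LinearMap.fst ℂ _ _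

theorem outerCoord_zero (t : Tableau m) (x : CombModel m W) :
    outerCoord t 0 x = x.2.1 fun i => t.label (.inl i) := rfl

theorem outerCoord_succ (t : Tableau m) (j : Fin m) (x : CombModel m W) :
    outerCoord t j.succ x = x.1 (t.label (.inr j)) := rfl

/-- The bracket before alternatization. -/
noncomputable def preBracket (w : Tableau m → W) :
    MultilinearMap ℂ (fun _ : Fin (m + 1) => CombModel m W) (CombModel m W) :=
  MultilinearMap.prod 0 <| MultilinearMap.prod
    (MultilinearMap.pi fun f => (MultilinearMap.mkPiAlgebra ℂ (Fin (m + 1)) ℂ).compLinearMap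
      fun i => LinearMap.proj (f i) ∘ₗ LinearMap.fst ℂ _ _)
    (∑ t : Tableau m, ((MultilinearMap.mkPiAlgebra ℂ (Fin (m + 1)) ℂ).compLinearMap
      (outerCoord t)).smulRight (w t))

theorem preBracket_apply (w : Tableau m → W) (x : Fin (m + 1) → CombModel m W) :
    preBracket w x = (0, fun f => ∏ i, (x i).1 (f i),
      ∑ t : Tableau m, (∏ i, outerCoord t i (x i)) • w t) := by
  refine Prod.ext rfl (Prod.ext rfl ?_)
  simp [preBracket]

/-- The bracket of the comb model. -/
noncomputable def altBracket (w : Tableau m → W) :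
    AlternatingMap ℂ (CombModel m W) (CombModel m W) (Fin (m + 1)) :=
  MultilinearMap.alternatization (preBracket w)

theorem altBracket_apply (w : Tableau m → W) (x : Fin (m + 1) → CombModel m W) :
    altBracket w x = (0, fun f => ∑ σ : Equiv.Perm (Fin (m + 1)), sgn σ * ∏ i, (x (σ i)).1 (f i),
      ∑ σ : Equiv.Perm (Fin (m + 1)), sgn σ •
        ∑ t : Tableau m, (∏ i, outerCoord t i (x (σ i))) • w t) := by
  have h : altBracket w x = ∑ σ : Equiv.Perm (Fin (m + 1)), sgn σ • preBracket w (x ∘ σ) := by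
    rw [altBracket, MultilinearMap.alternatization_apply]
    refine Finset.sum_congr rfl fun σ _ => ?_
    rw [MultilinearMap.domDomCongr_apply]
    rcases Int.units_eq_one_or (Equiv.Perm.sign σ) with h | h <;> simp [sgn, h] <;> rfl
  rw [h]
  simp only [preBracket_apply]
  refine Prod.ext ?_ (Prod.ext ?_ ?_)
  · simp [Prod.fst_sum]
  · funext f
    simp [Prod.fst_sum, Prod.snd_sum]
  · simp [Prod.snd_sum]

/-- The number of pairs of permutations of the two columns. -/
noncomputable def combScale (m : ℕ) : ℂ :=
  Fintype.card (Equiv.Perm (Fin m)) * Fintype.card (Equiv.Perm (Fin (m + 1)))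

theorem combScale_ne_zero (m : ℕ) : combScale m ≠ 0 :=
  mul_ne_zero (Nat.cast_ne_zero.2 Fintype.card_ne_zero) (Nat.cast_ne_zero.2 Fintype.card_ne_zero)

variable {w : Tableau m → W}

theorem combSum_sumCongr (hw : ∀ (t : Tableau m) (σ : Equiv.Perm (Fin (m + 1)))
    (τ : Equiv.Perm (Fin m)), w t = (sgn σ * sgn τ) • w (t.rearrange (Equiv.sumCongr σ τ)))
    (z : Cell m → Fin (2 * m + 1) → ℂ) (σ : Equiv.Perm (Fin (m + 1)))
    (τ : Equiv.Perm (Fin m)) :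
    (sgn τ * sgn σ) • combSum w (z ∘ Equiv.sumCongr σ τ) = combSum w z := by
  rw [combSum_comp, combSum, combSum, Finset.smul_sum]
  refine Finset.sum_congr rfl fun t _ => ?_
  rw [smul_comm, mul_comm (sgn τ), ← hw]

/-- An inner bracket has no generator component, so only the permutations keeping it in the first
slot survive. Expanding it gives one term for each pair of column permutations, and antisymmetry of
`w` makes all these terms equal. -/
theorem altBracket_altBracket (hw : ∀ (t : Tableau m) (σ : Equiv.Perm (Fin (m + 1)))
    (τ : Equiv.Perm (Fin m)), w t = (sgn σ * sgn τ) • w (t.rearrange (Equiv.sumCongr σ τ)))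
    (x : Fin (m + 1) → CombModel m W) (y : Fin m → CombModel m W) :
    altBracket w (Fin.cons (altBracket w x) y : Fin (m + 1) → CombModel m W) =
      (0, 0, combScale m •
        combSum w (Sum.elim (fun i => (x i).1) fun j => (y j).1)) := by
  set u := altBracket w x with hu
  have hu1 : u.1 = 0 := by rw [hu, altBracket_apply]
  have hu2 : ∀ f, u.2.1 f = ∑ σ : Equiv.Perm (Fin (m + 1)), sgn σ * ∏ i, (x (σ i)).1 (f i) := by
    intro f; rw [hu, altBracket_apply]
  rw [altBracket_apply]
  refine Prod.ext rfl (Prod.ext ?_ ?_)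
  · funext f
    refine Finset.sum_eq_zero fun σ _ => ?_
    rw [Finset.prod_eq_zero (Finset.mem_univ (σ.symm 0)), mul_zero]
    rw [Equiv.apply_symm_apply, Fin.cons_zero, hu1]
    rfl
  · change ∑ σ : Equiv.Perm (Fin (m + 1)), _ = _
    -- The permutations are sorted by their value `p` at `0`; those with `p = 0` are the
    -- permutations of `y`.
    rw [← Equiv.sum_comp Equiv.Perm.decomposeFin.symm, Fintype.sum_prod_type,
      Finset.sum_eq_single_of_mem (0 : Fin (m + 1)) (Finset.mem_univ _)]
    · have key : ∀ τ : Equiv.Perm (Fin m), sgn (Equiv.Perm.decomposeFin.symm (0, τ)) •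
          ∑ t : Tableau m, (∏ i, outerCoord t i ((Fin.cons u y : Fin (m + 1) → CombModel m W)
            (Equiv.Perm.decomposeFin.symm (0, τ) i))) • w t =
          (Fintype.card (Equiv.Perm (Fin (m + 1))) : ℂ) •
            combSum w (Sum.elim (fun i => (x i).1) fun j => (y j).1) := by
        intro τ
        have h1 : sgn (Equiv.Perm.decomposeFin.symm ((0 : Fin (m + 1)), τ)) = sgn τ := by
          simp [sgn, Equiv.Perm.decomposeFin.symm_sign]
        have h2 : ∀ t : Tableau m, (∏ i, outerCoord t i ((Fin.cons u y :
            Fin (m + 1) → CombModel m W) (Equiv.Perm.decomposeFin.symm (0, τ) i))) =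
            ∑ σ : Equiv.Perm (Fin (m + 1)), sgn σ * ∏ c, ((Sum.elim (fun i => (x i).1)
              fun j => (y j).1 : Cell m → Fin (2 * m + 1) → ℂ) ∘ Equiv.sumCongr σ τ) c
                (t.label c) := by
          intro t
          rw [Fin.prod_univ_succ, outerCoord_zero]
          simp only [outerCoord_succ, Equiv.Perm.decomposeFin_symm_apply_zero,
            Equiv.Perm.decomposeFin_symm_apply_succ, Equiv.swap_self, Equiv.refl_apply,
            Fin.cons_zero, Fin.cons_succ, hu2, Finset.sum_mul, Fintype.prod_sum_type]
          refine Finset.sum_congr rfl fun σ _ => ?_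
          rw [mul_assoc]
          rfl
        simp only [h1, h2, Finset.sum_smul]
        rw [Finset.sum_comm, Finset.smul_sum]
        refine (Finset.sum_congr rfl fun σ _ => ?_).trans (by
          rw [Finset.sum_const, Finset.card_univ, Nat.cast_smul_eq_nsmul])
        rw [← combSum_sumCongr hw _ σ τ, combSum, Finset.smul_sum, Finset.smul_sum]
        refine Finset.sum_congr rfl fun t _ => ?_
        rw [smul_smul, smul_smul, mul_assoc]
      rw [Finset.sum_congr rfl fun τ _ => key τ, Finset.sum_const, Finset.card_univ, combScale,
        ← Nat.cast_smul_eq_nsmul ℂ, smul_smul]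
    · intro p _ hp
      refine Finset.sum_eq_zero fun τ _ => ?_
      rw [Finset.sum_eq_zero, smul_zero]
      intro t _
      set σ : Equiv.Perm (Fin (m + 1)) := Equiv.Perm.decomposeFin.symm (p, τ) with hσ
      -- For `p ≠ 0` the inner bracket stands in a slot that reads generator coordinates, where it
      -- is zero.
      obtain ⟨j, hj⟩ : ∃ j : Fin m, j.succ = σ.symm 0 := by
        refine Fin.exists_succ_eq.2 fun h => hp ?_
        rw [Equiv.symm_apply_eq, hσ, Equiv.Perm.decomposeFin_symm_apply_zero] at h
        exact h.symm
      rw [Finset.prod_eq_zero (Finset.mem_univ j.succ), zero_smul]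
      rw [outerCoord_succ, hj, Equiv.apply_symm_apply, Fin.cons_zero, hu1]
      rfl

/-- The comb model as a LAnKe. -/
noncomputable abbrev lanke (w : Tableau m → W)
    (hw : ∀ (t : Tableau m) (σ : Equiv.Perm (Fin (m + 1))) (τ : Equiv.Perm (Fin m)),
      w t = (sgn σ * sgn τ) • w (t.rearrange (Equiv.sumCongr σ τ)))
    (hj : ∀ t : Tableau m, w t =
      ∑ i : Fin (m + 1), (-1 : ℂ) ^ (m - (i : ℕ)) • w (t.rearrange (jacobiPerm i))) :
    LAnKe m (CombModel m W) where
  bracket := (altBracket w).toMultilinearMap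
  antisymm x σ := by
    change altBracket w x = sgn σ • altBracket w (x ∘ σ)
    rw [AlternatingMap.map_perm]
    rcases Int.units_eq_one_or (Equiv.Perm.sign σ) with h | h <;> simp [sgn, h]
  jacobi x y := by
    simp only [AlternatingMap.coe_multilinearMap]
    simp only [altBracket_altBracket hw]
    set z : Cell m → Fin (2 * m + 1) → ℂ := Sum.elim (fun i => (x i).1) fun j => (y j).1 with hz
    -- The arguments of the `i`-th Jacobi term are those of the left side permuted by `jacobiPerm
    -- i`, so the identity for `w` transfers to its multilinear extension.
    have h1 : ∀ i : Fin (m + 1), (Sum.elim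
        (fun k => ((Fin.snoc y (x i) : Fin (m + 1) → CombModel m W) k).1)
        (fun j => (x (i.succAbove j)).1) : Cell m → Fin (2 * m + 1) → ℂ) = z ∘ jacobiPerm i := by
      intro i
      funext c
      rcases c with k | j
      · refine Fin.lastCases ?_ (fun k => ?_) k <;> simp [jacobiPerm, hz]
      · simp [jacobiPerm, hz]
    have h2 : combSum w z = ∑ i : Fin (m + 1), (-1 : ℂ) ^ (m - (i : ℕ)) •
        combSum w (z ∘ jacobiPerm i) := by
      simp only [combSum_comp]
      simp only [combSum, Finset.smul_sum]
      rw [Finset.sum_comm]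
      refine Finset.sum_congr rfl fun t _ => ?_
      conv_lhs => rw [hj t, Finset.smul_sum]
      exact Finset.sum_congr rfl fun i _ => smul_comm _ _ _
    simp only [h1]
    refine Prod.ext ?_ (Prod.ext ?_ ?_)
    · simp [Prod.fst_sum]
    · simp [Prod.fst_sum, Prod.snd_sum]
    · simp only [Prod.snd_sum, Prod.smul_snd]
      rw [h2, Finset.smul_sum]
      exact Finset.sum_congr rfl fun i _ => smul_comm _ _ _

end CombModel

/-- A function of tableaux satisfying the relations of combs extends to the free LAnKe. -/
theorem exists_linearMap_combWord_eval (w : Tableau m → W)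
    (hw : ∀ (t : Tableau m) (σ : Equiv.Perm (Fin (m + 1))) (τ : Equiv.Perm (Fin m)),
      w t = (sgn σ * sgn τ) • w (t.rearrange (Equiv.sumCongr σ τ)))
    (hj : ∀ t : Tableau m, w t =
      ∑ i : Fin (m + 1), (-1 : ℂ) ^ (m - (i : ℕ)) • w (t.rearrange (jacobiPerm i))) :
    ∃ F : FreeLAnKe m (Fin (2 * m + 1)) →ₗ[ℂ] W,
      ∀ t : Tableau m, F (combWord t).eval = CombModel.combScale m • w t := by
  let _ : LAnKe m (CombModel m W) := CombModel.lanke w hw hj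
  let gen : Fin (2 * m + 1) → CombModel m W := fun a => (Pi.single a 1, 0, 0)
  let G : LAnKeHom m (FreeLAnKe m (Fin (2 * m + 1))) (CombModel m W) := FreeLAnKe.lift gen
  refine ⟨LinearMap.snd ℂ _ _ ∘ₗ LinearMap.snd ℂ _ _ ∘ₗ G.toLinearMap, fun t => ?_⟩
  have h1 : G.toLinearMap (combWord t).eval = CombModel.altBracket w (Fin.cons
      (CombModel.altBracket w fun i => gen (t.label (.inl i)))
      (fun j => gen (t.label (.inr j))) : Fin (m + 1) → CombModel m W) := by
    rw [combWord_eval, G.map_bracket]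
    change CombModel.altBracket w _ = _
    congr 1
    funext i
    refine Fin.cases ?_ (fun j => ?_) i
    · exact G.map_bracket _
    · rfl
  rw [LinearMap.comp_apply, LinearMap.comp_apply, h1, CombModel.altBracket_altBracket hw]
  change CombModel.combScale m • combSum w _ = _
  congr 1
  rw [← combSum_single w t]
  congr 1
  funext c
  rcases c with i | j <;> rfl

end CombModel

/-! ### The kernel and the range of the canonical map -/

theorem combToRho_phi {m : ℕ} (v : CombSpace m) : combToRho m (phi m v) = 0 := by
  refine LinearMap.congr_fun (f := (combToRho m).toLinearMap ∘ₗ (phi m).toLinearMap) (g := 0)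
    (combSpace_hom_ext (W := (rhoSub m).toSubmodule) fun t => ?_) v
  change combToRho m (phi m (comb t)) = 0
  rw [phi_comb, map_sub, map_sum, sub_eq_zero, combToRho_comb]
  simp only [map_smul, combToRho_comb]
  refine Subtype.ext ?_
  rw [Submodule.coe_sum]
  change (combWord t).eval = ∑ i : Fin (m + 1), (-1 : ℂ) ^ (m - (i : ℕ)) •
    (combWord (t.rearrange (jacobiPerm i))).eval
  rw [combWord_eval, LAnKe.jacobi]
  refine Finset.sum_congr rfl fun i _ => ?_
  rw [combWord_eval]
  congr 3
  congr 1
  funext k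
  refine Fin.lastCases ?_ (fun k => ?_) k <;> simp [Tableau.label_rearrange, jacobiPerm]

/-- In the quotient by `im φ` the classes of combs satisfy both antisymmetry and Jacobi, so the comb
model applies. The quotient map then factors, up to a nonzero scalar, through the canonical map. -/
theorem mem_range_phi_of_combToRho_eq_zero {m : ℕ} {v : CombSpace m} (hv : combToRho m v = 0) :
    v ∈ (phi m).range.toSubmodule := by
  set q := (phi m).range.toSubmodule.mkQ
  obtain ⟨F, hF⟩ := exists_linearMap_combWord_eval (fun t => q (comb t))
    (fun t σ τ => by rw [← map_smul, ← comb_rearrange]) (fun t => by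
      simp only [← map_smul, ← map_sum]
      rw [← sub_eq_zero, ← map_sub, ← phi_comb]
      exact (Submodule.Quotient.mk_eq_zero _).2 ⟨comb t, rfl⟩)
  have h : F ∘ₗ (rhoSub m).toSubmodule.subtype ∘ₗ (combToRho m).toLinearMap =
      CombModel.combScale m • q := combSpace_hom_ext fun t => by
    change F (combToRho m (comb t)) = _
    rw [combToRho_comb]
    exact hF t
  have h1 := LinearMap.congr_fun h v
  change F (combToRho m v) = CombModel.combScale m • q v at h1
  rw [hv, Submodule.coe_zero, map_zero] at h1
  exact (Submodule.Quotient.mk_eq_zero _).1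
    ((smul_eq_zero.1 h1.symm).resolve_left (CombModel.combScale_ne_zero m))

theorem BracketWord.eq_of_of_numBr_eq_zero {m : ℕ} {X : Type} {u : BracketWord m X}
    (hu : u.numBr = 0) : ∃ x, u = .of x := by
  cases u with
  | of x => exact ⟨x, rfl⟩
  | br v => simp [BracketWord.numBr] at hu

/-- Every multilinear bracketed word is a comb up to a sign. -/
theorem exists_eval_eq_smul_combWord {m : ℕ} {u : BracketWord m (Fin (2 * m + 1))}
    (hu : u ∈ multilinearWords m) :
    ∃ (c : ℂ) (t : Tableau m), u.eval = c • (combWord t).eval := by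
  obtain ⟨hn, hocc⟩ := hu
  rcases u with a | v
  · simp [BracketWord.numBr] at hn
  have hn' : ∑ i, (v i).numBr = 1 := by
    rw [BracketWord.numBr] at hn; omega
  -- Exactly one argument of the outer bracket is itself a bracket, and all other arguments are
  -- generators.
  obtain ⟨i, hi⟩ : ∃ i, (v i).numBr ≠ 0 := by
    by_contra! h
    simp [h] at hn'
  rw [Fin.sum_univ_succAbove _ i] at hn'
  have hn0 : ∑ j, (v (i.succAbove j)).numBr = 0 := by omega
  have h0 : ∀ j, ∃ b, v (i.succAbove j) = .of b := fun j =>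
    BracketWord.eq_of_of_numBr_eq_zero (Finset.sum_eq_zero_iff.1 hn0 j (Finset.mem_univ j))
  choose b hb using h0
  rcases hvi : v i with a | w
  · rw [hvi] at hi; simp [BracketWord.numBr] at hi
  have h1 : ∑ k, (w k).numBr = 0 := by
    rw [hvi, BracketWord.numBr] at hn'; omega
  have h2 : ∀ k, ∃ a, w k = .of a := fun k =>
    BracketWord.eq_of_of_numBr_eq_zero (Finset.sum_eq_zero_iff.1 h1 k (Finset.mem_univ k))
  choose a ha using h2
  -- A label missing from both lists would occur zero times; with equal cardinalities, surjectivity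
  -- makes the word a filling.
  have hsurj : Function.Surjective (Sum.elim a b : Cell m → Fin (2 * m + 1)) := by
    intro x
    by_contra! h
    have h3 := hocc x
    rw [BracketWord.occ, Fin.sum_univ_succAbove _ i, hvi, BracketWord.occ] at h3
    have h4 : ∀ k, a k ≠ x := fun k => h (.inl k)
    have h5 : ∀ j, b j ≠ x := fun j => h (.inr j)
    simp [ha, hb, BracketWord.occ, h4, h5] at h3
  have hbij : Function.Bijective (Sum.elim a b : Cell m → Fin (2 * m + 1)) := by
    refine (Fintype.bijective_iff_surjective_and_card _).2 ⟨hsurj, ?_⟩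
    rw [Fintype.card_sum, Fintype.card_fin, Fintype.card_fin, Fintype.card_fin]
    omega
  let t : Tableau m := Equiv.ofBijective _ hbij
  -- This cycle brings the inner bracket to the front and keeps the order of the other arguments.
  refine ⟨sgn i.cycleRange⁻¹, t, ?_⟩
  rw [BracketWord.eval, LAnKe.antisymm (m := m) _ i.cycleRange⁻¹, combWord_eval]
  congr 2
  funext k
  refine Fin.cases ?_ (fun j => ?_) k
  · have h6 : i.cycleRange⁻¹ 0 = i := i.cycleRange_symm_zero
    rw [Function.comp_apply, h6, hvi, BracketWord.eval, Fin.cons_zero]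
    congr 1
    funext k
    rw [ha]
    rfl
  · have h6 : i.cycleRange⁻¹ j.succ = i.succAbove j := i.cycleRange_symm_succ j
    rw [Function.comp_apply, h6, hb, Fin.cons_succ]
    rfl

theorem combToRho_surjective (m : ℕ) : Function.Surjective (combToRho m) := by
  rintro ⟨x, hx⟩
  have hx' : x ∈ LinearMap.range
      ((rhoSub m).toSubmodule.subtype ∘ₗ (combToRho m).toLinearMap) := by
    refine (Submodule.span_le.2 ?_) hx
    rintro _ ⟨u, hu, rfl⟩
    obtain ⟨c, t, h⟩ := exists_eval_eq_smul_combWord hu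
    refine ⟨c • comb t, ?_⟩
    rw [h, map_smul]
    exact congrArg (fun y : (rhoSub m).toSubmodule => c • y.1) (combToRho_comb t)
  obtain ⟨v, hv⟩ := hx'
  exact ⟨v, Subtype.ext hv⟩

theorem combToRho_eq_zero_iff {m : ℕ} (v : CombSpace m) :
    combToRho m v = 0 ↔ v ∈ (phi m).range.toSubmodule := by
  refine ⟨mem_range_phi_of_combToRho_eq_zero, ?_⟩
  rintro ⟨v, rfl⟩
  exact combToRho_phi v

/-! ### The isomorphisms. -/

/-- The inclusion of the kernel of `φ`. -/
noncomputable def kerPhiSubtype (m : ℕ) : (kerPhi m).IntertwiningMap (combRep m) where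
  toLinearMap := (phi m).ker.toSubmodule.subtype
  isIntertwining' _ := rfl

/-- Common to `κ` and `Ψ`: a surjection that kills `im φ` already maps the complement `ker φ` onto
its target. -/
theorem bijective_comp_kerPhiSubtype {m : ℕ} {W : Type*} [AddCommMonoid W] [Module ℂ W]
    {σ : Representation ℂ (Equiv.Perm (Fin (2 * m + 1))) W}
    (F : (combRep m).IntertwiningMap σ) (hF : Function.Surjective F)
    (hphi : ∀ v, F (phi m v) = 0) (hker : ∀ v, phi m v = 0 → F v = 0 → v = 0) :
    Function.Bijective (F.comp (kerPhiSubtype m)) := by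
  constructor
  · refine (injective_iff_map_eq_zero (F.comp (kerPhiSubtype m))).2 fun v hv => ?_
    exact Subtype.ext (hker v v.2 hv)
  · intro x
    obtain ⟨v, rfl⟩ := hF x
    obtain ⟨a, ha, _, ⟨u, rfl⟩, rfl⟩ := Submodule.mem_sup.1
      ((isCompl_ker_range_phi m).sup_eq_top ▸ Submodule.mem_top : v ∈ _)
    refine ⟨⟨a, ha⟩, ?_⟩
    rw [map_add]
    change F a = F a + F (phi m u)
    rw [hphi, add_zero]

theorem theorem3p3 (m : ℕ) :
    ∃ (hc : IsCompl (phi m).ker.toSubmodule (phi m).range.toSubmodule)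
      (κ : (kerPhi m).Equiv (rho m)) (Ψ : (kerPhi m).Equiv (specht m)),
      (∀ v : (phi m).ker.toSubmodule, κ v = combToRho m (v : CombSpace m)) ∧
      (∀ v : (phi m).ker.toSubmodule, Ψ v = psiTilde m (v : CombSpace m)) ∧
      (∀ v : CombSpace m, Ψ (Submodule.projectionOnto _ _ hc v) = psiTilde m v) ∧
      (∀ t : Tableau m, Ψ (κ.symm (rhoComb t)) = spechtPolytabloid t) ∧
      Module.finrank ℂ (rhoSub m).toSubmodule = catalan (m + 1) := by
  have hc := isCompl_ker_range_phi m
  let κ := ((combToRho m).comp (kerPhiSubtype m)).ofBijective <|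
    bijective_comp_kerPhiSubtype (combToRho m) (combToRho_surjective m) combToRho_phi fun v h1 h2 =>
      Submodule.disjoint_def.1 hc.disjoint v h1 ((combToRho_eq_zero_iff v).1 h2)
  let Ψ := ((psiTilde m).comp (kerPhiSubtype m)).ofBijective <|
    bijective_comp_kerPhiSubtype (psiTilde m) (psiTilde_surjective m) psiTilde_phi fun _ =>
      eq_zero_of_phi_of_psiTilde
  have hκ : ∀ v : (phi m).ker.toSubmodule, κ v = combToRho m (v : CombSpace m) := fun _ => rfl
  have hΨ : ∀ v : (phi m).ker.toSubmodule, Ψ v = psiTilde m (v : CombSpace m) := fun _ => rfl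
  have hproj : ∀ v : CombSpace m,
      v - Submodule.projectionOnto _ _ hc v ∈ (phi m).range.toSubmodule := fun v => by
    rw [← Submodule.projectionOnto_apply_eq_zero_iff hc, map_sub,
      Submodule.projectionOnto_apply_left, sub_self]
  have hγ : ∀ v : CombSpace m, Ψ (Submodule.projectionOnto _ _ hc v) = psiTilde m v := fun v => by
    obtain ⟨u, hu⟩ := hproj v
    have h1 := psiTilde_phi u
    change psiTilde m ((phi m).toLinearMap u) = 0 at h1
    rw [hu, map_sub, sub_eq_zero] at h1
    exact h1.symm
  refine ⟨hc, κ, Ψ, hκ, hΨ, hγ, fun t => ?_, ?_⟩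
  -- A comb and its projection to `ker φ` differ by an element of `im φ`, so they have the same
  -- image in `ρ_{n,3}`; hence `κ⁻¹` of the bracket is the projection of the comb.
  · have h1 : κ (Submodule.projectionOnto _ _ hc (comb t)) = rhoComb t := by
      have h2 := (combToRho_eq_zero_iff _).2 (hproj (comb t))
      rw [map_sub, sub_eq_zero, combToRho_comb] at h2
      exact h2.symm
    rw [← h1, ← psiTilde_comb, ← hγ]
    congr 1
    exact κ.toLinearEquiv.symm_apply_apply _
  · rw [← finrank_ker_phi]
    exact κ.toLinearEquiv.finrank_eq.symm
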